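/- Let $\mathbb D$ be the unit disk, $H(\mathbb D)$ the space of analytic functions on $\mathbb D$, $\mathbb T=\partial\mathbb D$, and $dA=\frac1\pi\,dx\,dy$. Fix an aperture $\zeta>\frac12$ and put $\Gamma(\eta)=\{z\in\mathbb D:|z-\eta|<\zeta(1-|z|^2)\}$ for $\eta\in\mathbb T$. Let $S(0)=\mathbb D$ and, for $re^{i\theta}\in\mathbb D\setminus\{0\}$ with $r=|re^{i\theta}|$, let $S(re^{i\theta})=\{\lambda e^{it}\in\mathbb D: |t-\theta|\le\frac{1-r}2,\ 1-\lambda\le 1-r\}$. For $0<p<\infty$ and $\alpha>-2$, let $AT_p^\infty(\alpha)$ be the space of all $f\in H(\mathbb D)$ with $$\|f\|_{T_p^\infty(\alpha)}=\operatorname*{ess\,sup}_{\eta\in\mathbb T}\Big(\sup_{u\in\Gamma(\eta)}\frac1{1-|u|^2}\int_{S(u)}|f(z)|^p(1-|z|^2)^{\alpha+1}\,dA(z)\Big)^{1/p}<\infty,$$ and let $AT_{p,0}^\infty(\alpha)$ be the subspace, with the same quasi-norm, of those $f\in AT_p^\infty(\alpha)$ for which $$\lim_{|u|\to1^-}\frac1{1-|u|^2}\int_{S(u)}|f(z)|^p(1-|z|^2)^{\alpha+1}\,dA(z)=0.$$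 **Theorem.** Let $0<p\le q<\infty$, $\alpha,\beta>-2$, $g\in H(\mathbb D)$, and let $n\ge1$ and $k$ be integers with $0\le k<n$. Let $T_g^{n,k}f=I^n\big(f^{(k)}g^{(n-k)}\big)$ for $f\in H(\mathbb D)$, where $I^n$ is the $n$-th iterate of $Ih(z)=\int_0^z h(w)\,dw$. Then $T_g^{n,k}$ is bounded from $AT_{p,0}^\infty(\alpha)$ to $AT_{q,0}^\infty(\beta)$ (that is, $T_g^{n,k}$ maps $AT_{p,0}^\infty(\alpha)$ into $AT_{q,0}^\infty(\beta)$, and there is a constant $C<\infty$ with $\|T_g^{n,k}f\|_{T_q^\infty(\beta)}\le C\|f\|_{T_p^\infty(\alpha)}$ for all $f\in AT_{p,0}^\infty(\alpha)$) if and only if $$U_g=\sup_{z\in\mathbb D}|g^{(n-k)}(z)|\,(1-|z|^2)^{\,n-k+\frac{\beta+2}q-\frac{\alpha+2}p}<\infty .$$ -/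

import Mathlib

open scoped ENNReal NNReal Topology

noncomputable section

namespace TentSpace

/-- The open unit disk `𝔻` of the complex plane. -/
def disk : Set ℂ := Metric.ball (0 : ℂ) 1

/-- `H(𝔻)`: the analytic functions on the disk. A function on `𝔻` is represented by a function
`ℂ → ℂ` of which only the values on `𝔻` matter in everything below. -/
def analyticOnDisk : Set (ℂ → ℂ) := {f | DifferentiableOn ℂ f disk}

/-- The normalized area measure `dA = π⁻¹ dx dy`. -/
def areaMeasure : MeasureTheory.Measure ℂ :=
  ENNReal.ofReal (1 / Real.pi) • MeasureTheory.volume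

/-- The non-tangential region `Γ_ζ(η) = {z ∈ 𝔻 : |z - η| < ζ (1 - |z|²)}`. -/
def region (ζ : ℝ) (η : ℂ) : Set ℂ := {z | z ∈ disk ∧ ‖z - η‖ < ζ * (1 - ‖z‖ ^ 2)}

open Classical in
/-- The Carleson box `S(u)`: for `u = r e^{iθ} ≠ 0` the points `s e^{it}` of `𝔻` with
`|t - θ| ≤ (1 - r) / 2` and `1 - s ≤ 1 - r`; and `S(0) = 𝔻`. -/
def carlesonBox (u : ℂ) : Set ℂ :=
  if u = 0 then disk
  else {w | w ∈ disk ∧ ∃ s t : ℝ, w = (s : ℂ) * Complex.exp ((t : ℂ) * Complex.I) ∧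
    |t - Complex.arg u| ≤ (1 - ‖u‖) / 2 ∧ 1 - s ≤ 1 - ‖u‖}

/-- The average `(1 - |u|²)⁻¹ ∫_{S(u)} |f(z)|^p (1 - |z|²)^{α+1} dA(z)`, in `[0, ∞]`. -/
def boxAverage (p α : ℝ) (f : ℂ → ℂ) (u : ℂ) : ℝ≥0∞ :=
  ENNReal.ofReal (1 / (1 - ‖u‖ ^ 2)) *
    ∫⁻ z in carlesonBox u, ENNReal.ofReal (‖f z‖ ^ p * (1 - ‖z‖ ^ 2) ^ (α + 1)) ∂areaMeasure

/-- The quasi-norm `‖f‖_{T_p^∞(α)}` with aperture `ζ`, in `[0, ∞]`: the essential supremum, with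
respect to arc length on the unit circle (parametrized by `η = e^{iθ}`, `θ ∈ (0, 2π]`), of
`(sup_{u ∈ Γ_ζ(η)} boxAverage u)^{1/p}`. -/
def tentNorm (ζ p α : ℝ) (f : ℂ → ℂ) : ℝ≥0∞ :=
  essSup (fun θ : ℝ =>
      (⨆ u ∈ region ζ (Complex.exp ((θ : ℂ) * Complex.I)), boxAverage p α f u) ^ (1 / p))
    (MeasureTheory.volume.restrict (Set.Ioc 0 (2 * Real.pi)))

/-- The analytic tent space `AT_p^∞(α) = T_p^∞(α) ∩ H(𝔻)` (an analytic function on `𝔻` is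
automatically measurable there). -/
def analyticTent (ζ p α : ℝ) : Set (ℂ → ℂ) :=
  {f | f ∈ analyticOnDisk ∧ tentNorm ζ p α f < ∞}

/-- The little space `AT_{p,0}^∞(α)`: the `f ∈ AT_p^∞(α)` with `boxAverage u → 0` as
`|u| → 1⁻`. -/
def littleAnalyticTent (ζ p α : ℝ) : Set (ℂ → ℂ) :=
  {f | f ∈ analyticTent ζ p α ∧
    Filter.Tendsto (boxAverage p α f) (Filter.comap (fun u : ℂ => ‖u‖) (𝓝[<] (1 : ℝ))) (𝓝 0)}

/-- `I f(z) = ∫_0^z f(w) dw`, the integral along the segment from `0` to `z`. -/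
def integrationOp (f : ℂ → ℂ) : ℂ → ℂ :=
  fun z => ∫ t in (0 : ℝ)..1, f ((t : ℂ) * z) * z

/-- The generalized integration operator `T_g^{n,k} f = I^n (f^{(k)} g^{(n-k)})`. -/
def genIntegrationOp (g : ℂ → ℂ) (n k : ℕ) (f : ℂ → ℂ) : ℂ → ℂ :=
  integrationOp^[n] (fun z => iteratedDeriv k f z * iteratedDeriv (n - k) g z)

/-- `T` is bounded from `AT_{p,0}^∞(α)` to `AT_{q,0}^∞(β)` (each with the quasi-norm of the big
tent space): it maps the former into the latter, and `‖T f‖ ≤ C ‖f‖` with `C` independent of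
`f`. -/
def BoundedLittleTent (ζ p α q β : ℝ) (T : (ℂ → ℂ) → (ℂ → ℂ)) : Prop :=
  ∃ C : ℝ≥0, ∀ f ∈ littleAnalyticTent ζ p α,
    T f ∈ littleAnalyticTent ζ q β ∧ tentNorm ζ q β (T f) ≤ C * tentNorm ζ p α f

/-- `U_g = sup_{z ∈ 𝔻} |g^{(n-k)}(z)| (1 - |z|²)^{n - k + (β+2)/q - (α+2)/p}`, in `[0, ∞]`. -/
def weightedSup (p q α β : ℝ) (n k : ℕ) (g : ℂ → ℂ) : ℝ≥0∞ :=
  ⨆ z ∈ disk, ENNReal.ofReal (‖iteratedDeriv (n - k) g z‖ *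
    (1 - ‖z‖ ^ 2) ^ ((n : ℝ) - (k : ℝ) + (β + 2) / q - (α + 2) / p))

end TentSpace

end

namespace TentSpace

open MeasureTheory Metric Set
open scoped ComplexConjugate

/-! The tent quasi-norm is traded for a Carleson condition on balls centred on the unit circle: the
mass of `‖f‖ ^ p * (1 - ‖z‖) ^ (α + 1)` in the ball of radius `s` is at most `ω s * s`. A constant
`ω` describes the big space, and its size is comparable to the `p`-th power of the quasi-norm. The
little space is described by having, for every `ε > 0`, the gauge `ε + B * s ^ a` with some `B`.
Carrying a general gauge `ω` of polynomial growth through every estimate therefore gives the norm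
bound and the vanishing at the boundary by one argument.

Differentiation raises the weight exponent by `p` (`exists_carlesonBound_deriv`, from Cauchy's
estimate and Tonelli). Integration from the origin lowers it by `q`
(`exists_carlesonBound_integrationOp`), as long as the gauge exponent `a` satisfies `0 < a < γ + 1`,
with `γ` the final weight exponent.

For sufficiency, write `|f^(k) g^(n-k)|^q = |f^(k)|^p |f^(k)|^(q-p) |g^(n-k)|^q`. The factor of
power `q - p` is bounded by pointwise growth, the factor in `g` by `U_g`, and `|f^(k)|^p` carries
the gauge. The product satisfies a Carleson bound of exponent `q`, and `n` integrations finish.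

For necessity, test on normalized kernels `(1 - |a|)^(N-κ) / (1 - conj a z)^N` with `κ = (α + 2)/p`.
They lie in the little space with quasi-norm bounded uniformly in `a`. The `n`-th derivative of `T
f` is `f^(k) g^(n-k)`, and its pointwise growth at `z = a` bounds `g^(n-k)(a)`, since `f^(k)(a)` is
as large as possible there when `a` is away from `0`. -/

theorem rpow_le_rpow_of_comparable {x y K : ℝ} (c : ℝ) (hx : 0 < x) (hy : 0 < y) (hK : 0 < K)
    (hxy : x ≤ K * y) (hyx : y ≤ K * x) : x ^ c ≤ K ^ |c| * y ^ c := by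
  rcases le_total 0 c with hc | hc
  · rw [abs_of_nonneg hc, ← Real.mul_rpow hK.le hy.le]
    exact Real.rpow_le_rpow hx.le hxy hc
  · rw [abs_of_nonpos hc, Real.rpow_neg hK.le]
    have h := Real.rpow_le_rpow_of_nonpos hy hyx hc
    rw [Real.mul_rpow hK.le hx.le] at h
    have hKc : 0 < K ^ c := Real.rpow_pos_of_pos hK c
    rw [inv_mul_eq_div, le_div_iff₀ hKc]
    linarith

/-! ### Sub-mean value inequality for every positive exponent -/

/-- For `f` analytic, `‖f‖ ^ p` satisfies a sub-mean value inequality up to a constant, for every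
exponent `p > 0`. -/
theorem exists_rpow_norm_le_lintegral_ball {p : ℝ} (hp : 0 < p) :
    ∃ C : ℝ, 0 < C ∧ ∀ (f : ℂ → ℂ) (c : ℂ) (R : ℝ), 0 < R →
      DifferentiableOn ℂ f (closedBall c R) →
      ENNReal.ofReal (‖f c‖ ^ p * R ^ 2) ≤
        ENNReal.ofReal C * ∫⁻ w in ball c R, ENNReal.ofReal (‖f w‖ ^ p) := by
  set Q : ℝ := 2 ^ (2 / p) with hQ
  have hQ0 : 0 < Q := by positivity
  set m : ℝ := 1 / (2 * (Q + 2)) with hm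
  have hm0 : 0 < m := by positivity
  have hm1 : m ≤ 1 := by
    rw [hm, div_le_one (by positivity)]; linarith
  have hpi := Real.pi_pos
  refine ⟨4 * 2 ^ p / (Real.pi * m ^ 2), by positivity, fun f c R hR hf => ?_⟩
  rcases eq_or_ne (f c) 0 with h0 | h0
  · simp [h0, Real.zero_rpow hp.ne']
  -- No subharmonicity is needed. At a maximum `w₀` of this weighted modulus, halving the distance
  -- to the boundary costs at most the factor `Q = 2 ^ (2 / p)`, so `‖f‖ ≤ Q * ‖f w₀‖` on the ball
  -- of radius `ρ` about `w₀`.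
  have hcont : ContinuousOn (fun w => ‖f w‖ * (R - dist w c) ^ (2 / p)) (closedBall c R) := by
    refine hf.continuousOn.norm.mul (ContinuousOn.rpow_const (by fun_prop) ?_)
    intro x _
    exact Or.inr (by positivity)
  obtain ⟨w₀, hw₀, hmax⟩ := (isCompact_closedBall c R).exists_isMaxOn
    ⟨c, mem_closedBall_self hR.le⟩ hcont
  have hc : ‖f c‖ * R ^ (2 / p) ≤ ‖f w₀‖ * (R - dist w₀ c) ^ (2 / p) := by
    have := hmax (mem_closedBall_self hR.le)
    simpa using this
  have hpos : 0 < ‖f c‖ * R ^ (2 / p) := mul_pos (norm_pos_iff.2 h0) (by positivity)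
  have hd0 : 0 ≤ R - dist w₀ c := by simpa using sub_nonneg.2 (mem_closedBall.1 hw₀)
  have hd : 0 < R - dist w₀ c := by
    rcases hd0.eq_or_lt with h | h
    · rw [← h, Real.zero_rpow (by positivity)] at hc
      linarith
    · exact h
  set ρ : ℝ := (R - dist w₀ c) / 2 with hρ
  have hρ0 : 0 < ρ := by positivity
  have hfw : 0 < ‖f w₀‖ := by
    rcases (norm_nonneg (f w₀)).eq_or_lt with h | h
    · rw [← h] at hc; linarith
    · exact h
  have hsub : ball w₀ ρ ⊆ ball c R := by
    apply ball_subset_ball'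
    linarith
  have hbd : ∀ w ∈ ball w₀ ρ, ‖f w‖ ≤ Q * ‖f w₀‖ := by
    intro w hw
    have h1 : ‖f w‖ * (R - dist w c) ^ (2 / p) ≤ ‖f w₀‖ * (R - dist w₀ c) ^ (2 / p) :=
      hmax (ball_subset_closedBall (hsub hw))
    have h2 : ρ ≤ R - dist w c := by
      have := dist_triangle w w₀ c
      have := mem_ball.1 hw
      linarith
    have h3 : ρ ^ (2 / p) ≤ (R - dist w c) ^ (2 / p) :=
      Real.rpow_le_rpow hρ0.le h2 (by positivity)
    have h4 : (R - dist w₀ c) ^ (2 / p) = Q * ρ ^ (2 / p) := by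
      rw [hQ, ← Real.mul_rpow (by norm_num) hρ0.le]
      congr 1; rw [hρ]; ring
    rw [h4] at h1
    have h5 : 0 < ρ ^ (2 / p) := by positivity
    have h6 : ‖f w‖ * ρ ^ (2 / p) ≤ ‖f w₀‖ * (Q * ρ ^ (2 / p)) :=
      (mul_le_mul_of_nonneg_left h3 (norm_nonneg _)).trans h1
    have h7 : ‖f w‖ * ρ ^ (2 / p) ≤ (Q * ‖f w₀‖) * ρ ^ (2 / p) := by linarith
    exact le_of_mul_le_mul_right h7 h5
  have hlow : ∀ w ∈ ball w₀ (m * ρ), ‖f w₀‖ / 2 ≤ ‖f w‖ := by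
    intro w hw
    have hw' : w ∈ ball w₀ ρ := ball_subset_ball (by nlinarith) hw
    have hmaps : MapsTo f (ball w₀ ρ) (closedBall (f w₀) ((Q + 2) * ‖f w₀‖)) := by
      intro x hx
      rw [mem_closedBall, dist_eq_norm]
      have := norm_sub_le (f x) (f w₀)
      have := hbd x hx
      nlinarith
    -- The Schwarz lemma turns the upper bound on radius `ρ` into small oscillation on radius `m *
    -- ρ`; the value of `m` makes that oscillation at most `‖f w₀‖ / 2`.
    have hdist := Complex.dist_le_div_mul_dist_of_mapsTo_ball
      (hf.mono (hsub.trans ball_subset_closedBall)) hmaps hw'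
    have h1 : (Q + 2) * ‖f w₀‖ / ρ * dist w w₀ ≤ ‖f w₀‖ / 2 := by
      have h2 : dist w w₀ ≤ m * ρ := (mem_ball.1 hw).le
      calc (Q + 2) * ‖f w₀‖ / ρ * dist w w₀ ≤ (Q + 2) * ‖f w₀‖ / ρ * (m * ρ) := by gcongr
        _ = ‖f w₀‖ / 2 := by rw [hm]; field_simp
    have h2 : ‖f w₀‖ - ‖f w‖ ≤ dist (f w) (f w₀) := by
      rw [dist_comm, dist_eq_norm]; exact norm_sub_norm_le _ _
    linarith
  have hvol : ENNReal.ofReal ((‖f w₀‖ / 2) ^ p * (Real.pi * (m * ρ) ^ 2)) ≤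
      ∫⁻ w in ball c R, ENNReal.ofReal (‖f w‖ ^ p) := by
    calc ENNReal.ofReal ((‖f w₀‖ / 2) ^ p * (Real.pi * (m * ρ) ^ 2))
        = ENNReal.ofReal ((‖f w₀‖ / 2) ^ p) * volume (ball w₀ (m * ρ)) := by
          rw [Complex.volume_ball, ENNReal.ofReal_mul (by positivity), mul_comm Real.pi,
            ENNReal.ofReal_mul (by positivity), ENNReal.ofReal_pow (by positivity)]
          congr 2
          rw [← ENNReal.ofReal_coe_nnreal]; rfl
      _ = ∫⁻ w in ball w₀ (m * ρ), ENNReal.ofReal ((‖f w₀‖ / 2) ^ p) := by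
          rw [setLIntegral_const]
      _ ≤ ∫⁻ w in ball w₀ (m * ρ), ENNReal.ofReal (‖f w‖ ^ p) := by
          refine setLIntegral_mono' measurableSet_ball fun w hw => ?_
          exact ENNReal.ofReal_le_ofReal
            (Real.rpow_le_rpow (by positivity) (hlow w hw) hp.le)
      _ ≤ _ := lintegral_mono_set ((ball_subset_ball (by nlinarith)).trans hsub)
  have hfin : ‖f c‖ ^ p * R ^ 2 ≤
      4 * 2 ^ p / (Real.pi * m ^ 2) * ((‖f w₀‖ / 2) ^ p * (Real.pi * (m * ρ) ^ 2)) := by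
    have h1 := Real.rpow_le_rpow hpos.le hc hp.le
    rw [Real.mul_rpow (by positivity) (by positivity), Real.mul_rpow (by positivity) (by positivity),
      ← Real.rpow_mul hR.le, ← Real.rpow_mul hd.le, div_mul_cancel₀ _ hp.ne', Real.rpow_two,
      Real.rpow_two] at h1
    refine h1.trans (le_of_eq ?_)
    rw [Real.div_rpow (by positivity) (by norm_num), hρ]
    field_simp
    ring
  calc ENNReal.ofReal (‖f c‖ ^ p * R ^ 2) ≤ _ := ENNReal.ofReal_le_ofReal hfin
    _ = ENNReal.ofReal (4 * 2 ^ p / (Real.pi * m ^ 2)) * _ := ENNReal.ofReal_mul (by positivity)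
    _ ≤ _ := by gcongr

/-! ### Weighted area of balls centred on the circle -/

/-- Moving radially to the circle at most doubles the distance to `1`, and Jordan's inequality
bounds `2 * |sin (θ / 2)|` below by `2 * |θ| / π`. -/
theorem abs_le_pi_mul_of_norm_sub_one_lt {r θ s : ℝ} (hr : r ∈ Ioo 0 1) (hθ : |θ| ≤ Real.pi)
    (h : ‖(r : ℂ) * Complex.exp (θ * Complex.I) - 1‖ < s) : |θ| ≤ Real.pi * s := by
  have hpi := Real.pi_pos
  have hexp : ‖Complex.exp (θ * Complex.I)‖ = 1 := Complex.norm_exp_ofReal_mul_I θ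
  have h1 : 1 - r ≤ ‖(r : ℂ) * Complex.exp (θ * Complex.I) - 1‖ := by
    have := norm_sub_norm_le (1 : ℂ) ((r : ℂ) * Complex.exp (θ * Complex.I))
    rw [norm_sub_rev, norm_mul, hexp, Complex.norm_real, Real.norm_of_nonneg hr.1.le] at this
    simpa using this
  have h2 : ‖Complex.exp (θ * Complex.I) - 1‖ ≤ 2 * s := by
    have : Complex.exp (θ * Complex.I) - 1 = ((1 - r : ℝ) : ℂ) * Complex.exp (θ * Complex.I) +
        ((r : ℂ) * Complex.exp (θ * Complex.I) - 1) := by push_cast; ring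
    rw [this]
    refine (norm_add_le _ _).trans ?_
    rw [norm_mul, hexp, Complex.norm_real, Real.norm_of_nonneg (by linarith [hr.2])]
    linarith
  rw [mul_comm (θ : ℂ), Complex.norm_exp_I_mul_ofReal_sub_one, norm_mul, Real.norm_eq_abs,
    Real.norm_eq_abs, abs_two] at h2
  have h3 := Real.mul_abs_le_abs_sin (x := θ / 2) (by rw [abs_div, abs_two]; linarith)
  rw [abs_div, abs_two] at h3
  have h4 : 2 / Real.pi * (|θ| / 2) = |θ| / Real.pi := by ring
  rw [h4] at h3
  have : |θ| / Real.pi ≤ s := by linarith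
  rw [div_le_iff₀ hpi] at this
  linarith

theorem lintegral_Ioo_one_sub_rpow {c s : ℝ} (hc : -1 < c) (hs : 0 < s) :
    ∫⁻ r in Ioo (1 - s) 1, ENNReal.ofReal ((1 - r) ^ c) =
      ENNReal.ofReal (s ^ (c + 1) / (c + 1)) := by
  have hint : IntervalIntegrable (fun r : ℝ => (1 - r) ^ c) volume (1 - s) 1 := by
    have := (intervalIntegral.intervalIntegrable_rpow' (a := s) (b := 0) hc).comp_sub_left 1
    simpa using this
  have h1 : ∫ r in (1 - s)..1, (1 - r) ^ c = s ^ (c + 1) / (c + 1) := by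
    rw [intervalIntegral.integral_comp_sub_left (fun x => x ^ c) 1]
    simp only [sub_self, sub_sub_cancel]
    rw [integral_rpow (Or.inl hc), Real.zero_rpow (by linarith)]
    simp
  rw [← h1, intervalIntegral.integral_of_le (by linarith), integral_Ioc_eq_integral_Ioo,
    ofReal_integral_eq_lintegral_ofReal]
  · exact (intervalIntegrable_iff_integrableOn_Ioo_of_le (by linarith)).1 hint
  · refine (ae_restrict_iff' measurableSet_Ioo).2 (Filter.Eventually.of_forall fun r hr => ?_)
    exact Real.rpow_nonneg (by linarith [hr.2]) _

/-- In polar coordinates the region lies in the rectangle `1 - s < r < 1`, `|θ| ≤ π * s`, and the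
Jacobian `r` is at most `1`. The condition `-1 < c` is integrability in `r`. -/
theorem lintegral_disk_inter_ball_one_rpow_le {c s : ℝ} (hc : -1 < c) (hs : 0 < s) :
    ∫⁻ z in disk ∩ ball 1 s, ENNReal.ofReal ((1 - ‖z‖) ^ c) ≤
      ENNReal.ofReal (2 * Real.pi / (c + 1) * s ^ (c + 2)) := by
  have hpi := Real.pi_pos
  have hms : MeasurableSet (disk ∩ ball (1 : ℂ) s) := measurableSet_ball.inter measurableSet_ball
  rw [← lintegral_indicator hms, ← Complex.lintegral_comp_polarCoord_symm]
  set B : Set (ℝ × ℝ) := Ioo (1 - s) 1 ×ˢ Icc (-(Real.pi * s)) (Real.pi * s) with hB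
  have hBm : MeasurableSet B := measurableSet_Ioo.prod measurableSet_Icc
  calc _ ≤ ∫⁻ x in polarCoord.target,
        B.indicator (fun x => ENNReal.ofReal ((1 - x.1) ^ c)) x := by
        refine setLIntegral_mono' polarCoord.open_target.measurableSet fun x hx => ?_
        rw [polarCoord_target] at hx
        have hx1 : 0 < x.1 := hx.1
        have hx2 : |x.2| ≤ Real.pi := abs_le.2 ⟨hx.2.1.le, hx.2.2.le⟩
        have hz : Complex.polarCoord.symm x = (x.1 : ℂ) * Complex.exp (x.2 * Complex.I) := by
          rw [Complex.polarCoord_symm_apply, Complex.exp_mul_I]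
          push_cast; ring
        have hnorm : ‖Complex.polarCoord.symm x‖ = x.1 := by
          rw [hz, norm_mul, Complex.norm_exp_ofReal_mul_I, Complex.norm_real,
            Real.norm_of_nonneg hx1.le, mul_one]
        by_cases hmem : Complex.polarCoord.symm x ∈ disk ∩ ball (1 : ℂ) s
        · have hlt1 : x.1 < 1 := by
            have := hmem.1
            rw [disk, mem_ball_zero_iff, hnorm] at this
            exact this
          have hlts : ‖(x.1 : ℂ) * Complex.exp (x.2 * Complex.I) - 1‖ < s := by
            have := hmem.2
            rwa [mem_ball, dist_eq_norm, hz] at this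
          have hs1 : 1 - s < x.1 := by
            have := norm_sub_norm_le (1 : ℂ) (Complex.polarCoord.symm x)
            rw [norm_sub_rev, hnorm, hz, norm_one] at this
            linarith
          have hxB : x ∈ B := ⟨⟨hs1, hlt1⟩,
            abs_le.1 (abs_le_pi_mul_of_norm_sub_one_lt ⟨hx1, hlt1⟩ hx2 hlts)⟩
          rw [indicator_of_mem hmem, indicator_of_mem hxB, hnorm, smul_eq_mul]
          exact mul_le_of_le_one_left' (ENNReal.ofReal_le_one.2 hlt1.le)
        · rw [indicator_of_notMem hmem]; simp
    _ ≤ ∫⁻ x, B.indicator (fun x => ENNReal.ofReal ((1 - x.1) ^ c)) x :=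
        setLIntegral_le_lintegral _ _
    _ = ∫⁻ x in B, ENNReal.ofReal ((1 - x.1) ^ c) := lintegral_indicator hBm _
    _ = ∫⁻ r in Ioo (1 - s) 1, ∫⁻ _ in Icc (-(Real.pi * s)) (Real.pi * s),
          ENNReal.ofReal ((1 - r) ^ c) := by
        rw [hB, Measure.volume_eq_prod, ← Measure.prod_restrict, lintegral_prod]
        exact (by fun_prop : Measurable fun x : ℝ × ℝ =>
          ENNReal.ofReal ((1 - x.1) ^ c)).aemeasurable
    _ = ENNReal.ofReal (s ^ (c + 1) / (c + 1)) * ENNReal.ofReal (2 * Real.pi * s) := by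
        simp only [lintegral_const, Measure.restrict_apply_univ, Real.volume_Icc]
        rw [lintegral_mul_const' _ _ ENNReal.ofReal_ne_top, lintegral_Ioo_one_sub_rpow hc hs]
        congr 2; ring
    _ = _ := by
        have : 0 < c + 1 := by linarith
        rw [← ENNReal.ofReal_mul (by positivity)]
        congr 1
        rw [show c + 2 = (c + 1) + 1 by ring, Real.rpow_add_one hs.ne' (c + 1)]
        ring

theorem lintegral_disk_inter_ball_rpow_le {c s : ℝ} (hc : -1 < c) (hs : 0 < s) {η : ℂ}
    (hη : ‖η‖ = 1) :
    ∫⁻ z in disk ∩ ball η s, ENNReal.ofReal ((1 - ‖z‖) ^ c) ≤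
      ENNReal.ofReal (2 * Real.pi / (c + 1) * s ^ (c + 2)) := by
  refine le_trans (le_of_eq ?_) (lintegral_disk_inter_ball_one_rpow_le hc hs)
  let u : Circle := ⟨η, by simpa [Submonoid.unitSphere] using hη⟩
  have hmp : MeasurePreserving (rotation u) volume volume := (rotation u).measurePreserving
  have hn : ∀ z, ‖rotation u z‖ = ‖z‖ := (rotation u).norm_map
  have hpre : (rotation u) ⁻¹' (disk ∩ ball η s) = disk ∩ ball 1 s := by
    ext z
    have h1 : rotation u z - η = η * (z - 1) := by
      rw [rotation_apply]; change η * z - η = _; ring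
    simp only [mem_preimage, mem_inter_iff, disk, mem_ball, dist_eq_norm, h1, sub_zero, hn,
      norm_mul, hη, one_mul]
  rw [← hmp.setLIntegral_comp_preimage_emb
    (rotation u).toHomeomorph.measurableEmbedding, hpre]
  simp only [hn]

theorem mem_disk {z : ℂ} : z ∈ disk ↔ ‖z‖ < 1 := by simp [disk]

theorem isOpen_disk : IsOpen disk := isOpen_ball

/-! ### Gauges and Carleson bounds -/

/-- The density `‖f z‖ ^ p * (1 - ‖z‖) ^ γ` on the disk, extended by zero. -/
noncomputable def density (p γ : ℝ) (f : ℂ → ℂ) : ℂ → ℝ≥0∞ :=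
  disk.indicator fun z => ENNReal.ofReal (‖f z‖ ^ p * (1 - ‖z‖) ^ γ)

/-- A gauge of exponent `a`: the value at a larger scale is controlled by the value at a smaller
one. -/
structure IsGauge (a : ℝ) (ω : ℝ → ℝ) : Prop where
  nonneg : ∀ s, 0 < s → 0 ≤ ω s
  le_rpow_mul : ∀ s t, 0 < s → s ≤ t → ω t ≤ (t / s) ^ a * ω s

/-- The mass of `‖f‖ ^ p * (1 - ‖z‖) ^ γ` in the balls of radius `s` centred on the unit circle is
at most `ω s * s`. -/
def CarlesonBound (p γ : ℝ) (f : ℂ → ℂ) (ω : ℝ → ℝ) : Prop :=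
  ∀ η : ℂ, ‖η‖ = 1 → ∀ s : ℝ, 0 < s →
    ∫⁻ z in ball η s, density p γ f z ≤ ENNReal.ofReal (ω s * s)

theorem isGauge_const {a M : ℝ} (ha : 0 ≤ a) (hM : 0 ≤ M) : IsGauge a fun _ => M where
  nonneg _ _ := hM
  le_rpow_mul _ _ hs hst :=
    le_mul_of_one_le_left hM (Real.one_le_rpow ((one_le_div hs).2 hst) ha)

/-- This gauge encodes membership in the little space: `A` arbitrarily small, `B` depending on `A`.
-/
theorem isGauge_add_mul_rpow {a A B : ℝ} (ha : 0 ≤ a) (hA : 0 ≤ A) (hB : 0 ≤ B) :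
    IsGauge a fun s => A + B * s ^ a where
  nonneg s hs := by positivity
  le_rpow_mul s t hs hst := by
    have h1 : 1 ≤ (t / s) ^ a := Real.one_le_rpow ((one_le_div hs).2 hst) ha
    have ht : 0 < t := hs.trans_le hst
    have h2 : (t / s) ^ a * s ^ a = t ^ a := by
      rw [← Real.mul_rpow (by positivity) hs.le, div_mul_cancel₀ _ hs.ne']
    calc A + B * t ^ a = A + B * ((t / s) ^ a * s ^ a) := by rw [h2]
      _ ≤ (t / s) ^ a * A + B * ((t / s) ^ a * s ^ a) := by
        gcongr; exact le_mul_of_one_le_left hA h1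
      _ = _ := by ring

theorem IsGauge.const_mul {a C : ℝ} {ω : ℝ → ℝ} (h : IsGauge a ω) (hC : 0 ≤ C) :
    IsGauge a fun s => C * ω s where
  nonneg s hs := mul_nonneg hC (h.nonneg s hs)
  le_rpow_mul s t hs hst := by
    have := mul_le_mul_of_nonneg_left (h.le_rpow_mul s t hs hst) hC
    linarith

theorem IsGauge.apply_mul_le {a K s : ℝ} {ω : ℝ → ℝ} (h : IsGauge a ω) (hK : 1 ≤ K) (hs : 0 < s) :
    ω (K * s) ≤ K ^ a * ω s := by
  have := h.le_rpow_mul s (K * s) hs (by nlinarith)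
  rwa [mul_div_assoc, div_self hs.ne', mul_one] at this

theorem measurable_density {p : ℝ} (hp : 0 < p) (γ : ℝ) {f : ℂ → ℂ} (hf : ContinuousOn f disk) :
    Measurable (density p γ f) := by
  classical
  have hcont : ContinuousOn (fun z => ENNReal.ofReal (‖f z‖ ^ p * (1 - ‖z‖) ^ γ)) disk := by
    refine ENNReal.continuous_ofReal.comp_continuousOn
      ((hf.norm.rpow_const fun _ _ => Or.inr hp.le).mul
        (ContinuousOn.rpow_const (by fun_prop) fun z hz => Or.inl ?_))
    have := mem_disk.1 hz
    exact (sub_pos.2 this).ne'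
  rw [density, ← Set.piecewise_eq_indicator]
  exact hcont.measurable_piecewise continuousOn_const isOpen_disk.measurableSet

theorem exists_norm_eq_one_norm_sub_eq (z : ℂ) (hz : z ∈ disk) :
    ∃ η : ℂ, ‖η‖ = 1 ∧ ‖z - η‖ = 1 - ‖z‖ := by
  rcases eq_or_ne z 0 with rfl | h
  · exact ⟨1, by simp, by simp⟩
  · have hz1 := mem_disk.1 hz
    have hn : 0 < ‖z‖ := norm_pos_iff.2 h
    have hnc : (‖z‖ : ℂ) ≠ 0 := by exact_mod_cast hn.ne'
    refine ⟨z / ‖z‖, by simp [hn.ne'], ?_⟩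
    have : z - z / ‖z‖ = ((‖z‖ - 1 : ℝ) : ℂ) * (z / ‖z‖) := by push_cast; field_simp
    rw [this, norm_mul, norm_div, Complex.norm_real, Complex.norm_real, norm_norm, div_self hn.ne',
      mul_one, Real.norm_eq_abs, abs_of_nonpos (by linarith)]
    ring

theorem one_sub_norm_le_of_norm_eq_one {η z : ℂ} (hη : ‖η‖ = 1) : 1 - ‖z‖ ≤ ‖z - η‖ := by
  rw [← hη, norm_sub_rev]; exact norm_sub_norm_le _ _

/-! ### Pointwise estimates from local mass -/

/-- Local estimate of the values of an analytic function near `z` by its mass near `z`. -/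
theorem exists_rpow_norm_le_lintegral_density {p : ℝ} (hp : 0 < p) (γ : ℝ) :
    ∃ C : ℝ, 0 < C ∧ ∀ f ∈ analyticOnDisk, ∀ z ∈ disk, ∀ w ∈ closedBall z ((1 - ‖z‖) / 4),
      ENNReal.ofReal (‖f w‖ ^ p * (1 - ‖z‖) ^ (γ + 2)) ≤
        ENNReal.ofReal C * ∫⁻ x in ball z ((1 - ‖z‖) / 2), density p γ f x := by
  obtain ⟨C, hC, h⟩ := exists_rpow_norm_le_lintegral_ball hp
  -- The `16` undoes the square of the radius `d / 4`; `2 ^ |γ|` compares the weights, since `1 -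
  -- ‖x‖` is within a factor `2` of `d` on the ball of radius `d / 2`.
  refine ⟨16 * 2 ^ |γ| * C, by positivity, fun f hf z hz w hw => ?_⟩
  have hz1 := mem_disk.1 hz
  set d := 1 - ‖z‖ with hd
  have hd0 : 0 < d := by linarith
  rw [mem_closedBall, dist_eq_norm] at hw
  have hsub : closedBall w (d / 4) ⊆ disk := by
    intro x hx
    rw [mem_closedBall, dist_eq_norm] at hx
    rw [mem_disk]
    have h1 := norm_le_insert' x w
    have h2 := norm_le_insert' w z
    linarith
  have hsub' : ball w (d / 4) ⊆ ball z (d / 2) := by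
    apply ball_subset_ball'
    rw [dist_eq_norm]; linarith
  have h1 := h f w (d / 4) (by positivity) (DifferentiableOn.mono hf hsub)
  have h2 : ∀ x ∈ ball w (d / 4), ENNReal.ofReal (‖f x‖ ^ p) ≤
      ENNReal.ofReal (2 ^ |γ| * d ^ (-γ)) * density p γ f x := by
    intro x hx
    have hxd : x ∈ disk := hsub (ball_subset_closedBall hx)
    have hx1 := mem_disk.1 hxd
    have hxz := hsub' hx
    rw [mem_ball, dist_eq_norm] at hxz
    have h3 := norm_le_insert' x z
    have h4 := norm_le_insert x z
    have h5 : d ^ γ ≤ 2 ^ |γ| * (1 - ‖x‖) ^ γ :=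
      rpow_le_rpow_of_comparable γ hd0 (by linarith) (by norm_num) (by linarith) (by linarith)
    rw [density, indicator_of_mem hxd, ← ENNReal.ofReal_mul (by positivity)]
    apply ENNReal.ofReal_le_ofReal
    have h6 : 0 < d ^ γ := by positivity
    rw [Real.rpow_neg hd0.le]
    calc ‖f x‖ ^ p = ‖f x‖ ^ p * (d ^ γ * (d ^ γ)⁻¹) := by rw [mul_inv_cancel₀ h6.ne', mul_one]
      _ ≤ ‖f x‖ ^ p * (2 ^ |γ| * (1 - ‖x‖) ^ γ * (d ^ γ)⁻¹) := by gcongr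
      _ = _ := by ring
  have h3 : ∫⁻ x in ball w (d / 4), ENNReal.ofReal (‖f x‖ ^ p) ≤
      ENNReal.ofReal (2 ^ |γ| * d ^ (-γ)) * ∫⁻ x in ball z (d / 2), density p γ f x := by
    rw [← lintegral_const_mul' _ _ ENNReal.ofReal_ne_top]
    exact (setLIntegral_mono' measurableSet_ball h2).trans (lintegral_mono_set hsub')
  calc ENNReal.ofReal (‖f w‖ ^ p * d ^ (γ + 2))
      = ENNReal.ofReal (16 * d ^ γ) * ENNReal.ofReal (‖f w‖ ^ p * (d / 4) ^ 2) := by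
        rw [← ENNReal.ofReal_mul (by positivity), Real.rpow_add hd0, Real.rpow_two]
        congr 1; ring
    _ ≤ ENNReal.ofReal (16 * d ^ γ) * (ENNReal.ofReal C * (ENNReal.ofReal (2 ^ |γ| * d ^ (-γ)) *
          ∫⁻ x in ball z (d / 2), density p γ f x)) := by gcongr; exact h1.trans (by gcongr)
    _ = _ := by
        rw [← mul_assoc, ← mul_assoc, ← ENNReal.ofReal_mul (by positivity),
          ← ENNReal.ofReal_mul (by positivity)]
        congr 2
        rw [Real.rpow_neg hd0.le]
        have h6 : 0 < d ^ γ := by positivity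
        field_simp

/-- Cauchy's estimate on the circle of radius `(1 - ‖z‖) / 4`, on which the preceding local estimate
is uniform; the radius accounts for the extra `p` in the exponent. -/
theorem exists_rpow_norm_deriv_le_lintegral_density {p : ℝ} (hp : 0 < p) (γ : ℝ) :
    ∃ C : ℝ, 0 < C ∧ ∀ f ∈ analyticOnDisk, ∀ z ∈ disk,
      ENNReal.ofReal (‖deriv f z‖ ^ p * (1 - ‖z‖) ^ (γ + p + 2)) ≤
        ENNReal.ofReal C * ∫⁻ x in ball z ((1 - ‖z‖) / 2), density p γ f x := by
  obtain ⟨C, hC, h⟩ := exists_rpow_norm_le_lintegral_density hp γ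
  refine ⟨4 ^ p * C, by positivity, fun f hf z hz => ?_⟩
  have h0 := h f hf z hz
  have hz1 := mem_disk.1 hz
  set d := 1 - ‖z‖ with hd
  have hd0 : 0 < d := by linarith
  set S := ∫⁻ x in ball z (d / 2), density p γ f x with hS
  rcases eq_or_ne S ⊤ with hST | hST
  · rw [hST, ENNReal.mul_top (by positivity)]; exact le_top
  have hw : ∀ w ∈ closedBall z (d / 4), ‖f w‖ ≤ (C * S.toReal * d ^ (-(γ + 2))) ^ (1 / p) := by
    intro w hw
    have h1 := h0 w hw
    rw [← ENNReal.ofReal_toReal hST, ← ENNReal.ofReal_mul hC.le,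
      ENNReal.ofReal_le_ofReal_iff (by positivity)] at h1
    rw [one_div, Real.le_rpow_inv_iff_of_pos (norm_nonneg _) (by positivity) hp,
      Real.rpow_neg hd0.le, ← div_eq_mul_inv, le_div_iff₀ (by positivity)]
    exact h1
  have hsub : closedBall z (d / 4) ⊆ disk := by
    intro x hx
    rw [mem_closedBall, dist_eq_norm] at hx
    rw [mem_disk]
    have h1 := norm_le_insert' x z
    linarith
  have hder := Complex.norm_deriv_le_of_forall_mem_sphere_norm_le (c := z) (R := d / 4) (f := f)
    (by positivity) ((DifferentiableOn.mono hf hsub).diffContOnCl_ball subset_rfl)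
    (fun w hw' => hw w (sphere_subset_closedBall hw'))
  rw [← ENNReal.ofReal_toReal hST, ← ENNReal.ofReal_mul (by positivity)]
  apply ENNReal.ofReal_le_ofReal
  have h1 := Real.rpow_le_rpow (norm_nonneg _) hder hp.le
  have hX : 0 ≤ C * S.toReal * d ^ (-(γ + 2)) := by positivity
  rw [Real.div_rpow (by positivity) (by positivity), one_div, Real.rpow_inv_rpow hX hp.ne',
    Real.div_rpow hd0.le (by norm_num)] at h1
  have h2 : 0 < d ^ p := by positivity
  have h3 : 0 < d ^ (γ + 2) := by positivity
  rw [Real.rpow_neg hd0.le] at h1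
  calc ‖deriv f z‖ ^ p * d ^ (γ + p + 2) = ‖deriv f z‖ ^ p * (d ^ (γ + 2) * d ^ p) := by
        rw [← Real.rpow_add hd0]; ring_nf
    _ ≤ C * S.toReal * (d ^ (γ + 2))⁻¹ / (d ^ p / 4 ^ p) * (d ^ (γ + 2) * d ^ p) := by gcongr
    _ = _ := by field_simp

/-- With `d = 1 - ‖z‖`, the ball of radius `d / 2` about `z` sits in the ball of radius `2 * d`
about the radial projection of `z`. The linear factor in `ω s * s` cancels one power of `d`. -/
theorem exists_growth_of_carlesonBound {p : ℝ} (hp : 0 < p) (γ a : ℝ) :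
    ∃ C : ℝ, 0 < C ∧ ∀ f ∈ analyticOnDisk, ∀ ω, IsGauge a ω → CarlesonBound p γ f ω →
      ∀ z ∈ disk, ‖f z‖ ^ p * (1 - ‖z‖) ^ (γ + 1) ≤ C * ω (1 - ‖z‖) := by
  obtain ⟨C, hC, h⟩ := exists_rpow_norm_le_lintegral_density hp γ
  refine ⟨C * 2 ^ a * 2, by positivity, fun f hf ω hω hcb z hz => ?_⟩
  have hz1 := mem_disk.1 hz
  have h1 := h f hf z hz z (mem_closedBall_self (by linarith))
  set d := 1 - ‖z‖ with hd
  have hd0 : 0 < d := by linarith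
  obtain ⟨η, hη, hηz⟩ := exists_norm_eq_one_norm_sub_eq z hz
  have hsub : ball z (d / 2) ⊆ ball η (2 * d) := by
    apply ball_subset_ball'
    rw [dist_eq_norm, hηz]; linarith
  have h2 := (lintegral_mono_set (f := density p γ f) (μ := volume) hsub).trans
    (hcb η hη (2 * d) (by positivity))
  have hωd := hω.nonneg d hd0
  have h3 : ENNReal.ofReal (‖f z‖ ^ p * d ^ (γ + 2)) ≤
      ENNReal.ofReal (C * (2 ^ a * ω d * (2 * d))) := by
    rw [ENNReal.ofReal_mul hC.le]
    refine h1.trans ?_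
    gcongr
    refine h2.trans (ENNReal.ofReal_le_ofReal ?_)
    gcongr
    exact hω.apply_mul_le (by norm_num) hd0
  rw [ENNReal.ofReal_le_ofReal_iff (by positivity), show γ + 2 = γ + 1 + 1 by ring,
    Real.rpow_add_one hd0.ne'] at h3
  refine le_of_mul_le_mul_right ?_ hd0
  linarith

/-! ### Differentiation of Carleson bounds -/

/-- Tonelli in the form used for both differentiation and integration: a pointwise bound at `z` by
the mass over the `w` related to `z` becomes a weight at `w`. -/
theorem lintegral_mul_setLIntegral_swap {φ ψ : ℂ → ℝ≥0∞} (hφ : Measurable φ) (hψ : Measurable ψ)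
    {R : Set (ℂ × ℂ)} (hR : MeasurableSet R) :
    ∫⁻ z, ψ z * ∫⁻ w in {w | (z, w) ∈ R}, φ w = ∫⁻ w, φ w * ∫⁻ z in {z | (z, w) ∈ R}, ψ z := by
  set H : ℂ × ℂ → ℝ≥0∞ := R.indicator fun x => ψ x.1 * φ x.2 with hH
  have hHm : Measurable H := ((hψ.comp measurable_fst).mul (hφ.comp measurable_snd)).indicator hR
  have h1 : ∀ z, ψ z * ∫⁻ w in {w | (z, w) ∈ R}, φ w = ∫⁻ w, H (z, w) := by
    intro z
    have hm : MeasurableSet {w | (z, w) ∈ R} := measurable_prodMk_left hR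
    rw [← lintegral_indicator hm, ← lintegral_const_mul _ (hφ.indicator hm)]
    refine lintegral_congr fun w => ?_
    by_cases hw : (z, w) ∈ R <;> simp [hH, indicator, hw]
  have h2 : ∀ w, φ w * ∫⁻ z in {z | (z, w) ∈ R}, ψ z = ∫⁻ z, H (z, w) := by
    intro w
    have hm : MeasurableSet {z | (z, w) ∈ R} := measurable_prodMk_right hR
    rw [← lintegral_indicator hm, ← lintegral_const_mul _ (hψ.indicator hm)]
    refine lintegral_congr fun z => ?_
    by_cases hw : (z, w) ∈ R <;> simp [hH, indicator, hw, mul_comm]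
  simp only [h1, h2]
  exact lintegral_lintegral_swap (f := fun z w => H (z, w)) hHm.aemeasurable

theorem measurable_indicator_disk_inter_ball_rpow (η : ℂ) (s c : ℝ) :
    Measurable ((disk ∩ ball η s).indicator fun z => ENNReal.ofReal ((1 - ‖z‖) ^ c)) :=
  Measurable.indicator (by fun_prop) (isOpen_disk.measurableSet.inter measurableSet_ball)

theorem setLIntegral_density (p γ : ℝ) (f : ℂ → ℂ) (A : Set ℂ) :
    ∫⁻ z in A, density p γ f z =
      ∫⁻ z in disk ∩ A, ENNReal.ofReal (‖f z‖ ^ p * (1 - ‖z‖) ^ γ) :=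
  setLIntegral_indicator isOpen_disk.measurableSet _

/-- The derivative of a function satisfying a Carleson bound satisfies the Carleson bound with
weight raised by `p`. -/
theorem exists_carlesonBound_deriv {p : ℝ} (hp : 0 < p) (γ a : ℝ) :
    ∃ C : ℝ, 0 < C ∧ ∀ f ∈ analyticOnDisk, ∀ ω, IsGauge a ω → CarlesonBound p γ f ω →
      CarlesonBound p (γ + p) (deriv f) fun s => C * ω s := by
  obtain ⟨C, hC, h⟩ := exists_rpow_norm_deriv_le_lintegral_density hp γ
  have hpi := Real.pi_pos
  refine ⟨C * (9 / 4 * Real.pi) * 2 ^ a * 2, by positivity, fun f hf ω hω hcb η hη s hs => ?_⟩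
  have hωs := hω.nonneg s hs
  -- For fixed `w` in the disk, the related `z` in the disk lie within `d = 1 - ‖w‖` of `w` and have
  -- `1 - ‖z‖ ≥ 2 / 3 * d`. Hence `(1 - ‖z‖) ^ (-2)` integrates to at most `9 / 4 * π`, and the swap
  -- loses only a constant.
  set R : Set (ℂ × ℂ) := {x | ‖x.2 - x.1‖ < (1 - ‖x.1‖) / 2} with hR
  have hRm : MeasurableSet R := measurableSet_lt (by fun_prop) (by fun_prop)
  set ψ : ℂ → ℝ≥0∞ :=
    (disk ∩ ball η s).indicator fun z => ENNReal.ofReal ((1 - ‖z‖) ^ (-2 : ℝ)) with hψ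
  have hψm : Measurable ψ := measurable_indicator_disk_inter_ball_rpow η s (-2)
  have hφm : Measurable (density p γ f) := measurable_density hp γ (DifferentiableOn.continuousOn hf)
  have hms : MeasurableSet (disk ∩ ball η s) := isOpen_disk.measurableSet.inter measurableSet_ball
  have hin : ∀ w, density p γ f w * ∫⁻ z in {z | (z, w) ∈ R}, ψ z ≤
      (ball η (2 * s)).indicator (fun w => ENNReal.ofReal (9 / 4 * Real.pi) * density p γ f w) w := by
    intro w
    by_cases hwd : w ∈ disk
    swap
    · simp [density, hwd]
    have hw1 := mem_disk.1 hwd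
    by_cases hw : w ∈ ball η (2 * s)
    · rw [indicator_of_mem hw, mul_comm]
      gcongr
      set d := 1 - ‖w‖ with hd
      have hd0 : 0 < d := by linarith
      have hRm' : MeasurableSet {z | (z, w) ∈ R} := measurable_prodMk_right hRm
      calc ∫⁻ z in {z | (z, w) ∈ R}, ψ z
          ≤ ∫⁻ z in {z | (z, w) ∈ R}, ENNReal.ofReal (9 / 4 * d ^ (-2 : ℝ)) := by
            refine setLIntegral_mono' hRm' fun z hz => ?_
            have hz' : ‖w - z‖ < (1 - ‖z‖) / 2 := hz
            by_cases hzd : z ∈ disk ∩ ball η s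
            · rw [hψ, indicator_of_mem hzd]
              apply ENNReal.ofReal_le_ofReal
              have hz1 := mem_disk.1 hzd.1
              have h3 := norm_le_insert w z
              have h4 : 2 / 3 * d ≤ 1 - ‖z‖ := by linarith
              calc (1 - ‖z‖) ^ (-2 : ℝ) ≤ (2 / 3 * d) ^ (-2 : ℝ) :=
                    Real.rpow_le_rpow_of_nonpos (by positivity) h4 (by norm_num)
                _ = 9 / 4 * d ^ (-2 : ℝ) := by
                    rw [Real.mul_rpow (by norm_num) hd0.le]
                    congr 1
                    rw [Real.rpow_neg (by norm_num), Real.rpow_two]; norm_num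
            · rw [hψ, indicator_of_notMem hzd]; simp
        _ ≤ ∫⁻ z in ball w d, ENNReal.ofReal (9 / 4 * d ^ (-2 : ℝ)) := by
            refine lintegral_mono_set fun z hz => ?_
            have hz' : ‖w - z‖ < (1 - ‖z‖) / 2 := hz
            rw [mem_ball, dist_eq_norm, norm_sub_rev]
            have h3 := norm_le_insert' w z
            linarith
        _ = ENNReal.ofReal (9 / 4 * Real.pi) := by
            rw [setLIntegral_const, Complex.volume_ball, ← ENNReal.ofReal_pow hd0.le,
              ← ENNReal.ofReal_coe_nnreal, ← ENNReal.ofReal_mul (by positivity),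
              ← ENNReal.ofReal_mul (by positivity)]
            congr 1
            rw [Real.rpow_neg hd0.le, Real.rpow_two, NNReal.coe_real_pi]
            field_simp
    · rw [indicator_of_notMem hw]
      have : ∫⁻ z in {z | (z, w) ∈ R}, ψ z = 0 := by
        refine setLIntegral_eq_zero (measurable_prodMk_right hRm) fun z hz => ?_
        have hz' : ‖w - z‖ < (1 - ‖z‖) / 2 := hz
        refine indicator_of_notMem (fun hzd => hw ?_) _
        have hz2 := hzd.2
        rw [mem_ball, dist_eq_norm] at hz2 ⊢
        have h3 := one_sub_norm_le_of_norm_eq_one (z := z) hη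
        have h4 := norm_sub_le_norm_sub_add_norm_sub w z η
        linarith
      simp [this]
  have hpt : ∀ z ∈ disk ∩ ball η s,
      ENNReal.ofReal (‖deriv f z‖ ^ p * (1 - ‖z‖) ^ (γ + p)) ≤
        ENNReal.ofReal C * (ψ z * ∫⁻ w in {w | (z, w) ∈ R}, density p γ f w) := by
    intro z hz
    have hz1 := mem_disk.1 hz.1
    have h1 := h f hf z hz.1
    have hset : {w | (z, w) ∈ R} = ball z ((1 - ‖z‖) / 2) := by
      ext w; simp [hR, dist_eq_norm]
    rw [hset, hψ, indicator_of_mem hz, mul_left_comm]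
    have hd0 : 0 < 1 - ‖z‖ := by linarith
    calc ENNReal.ofReal (‖deriv f z‖ ^ p * (1 - ‖z‖) ^ (γ + p))
        = ENNReal.ofReal ((1 - ‖z‖) ^ (-2 : ℝ)) *
          ENNReal.ofReal (‖deriv f z‖ ^ p * (1 - ‖z‖) ^ (γ + p + 2)) := by
          rw [← ENNReal.ofReal_mul (by positivity), mul_left_comm, ← Real.rpow_add hd0]
          congr 3; ring
      _ ≤ _ := by gcongr
  calc ∫⁻ z in ball η s, density p (γ + p) (deriv f) z
      = ∫⁻ z in disk ∩ ball η s, ENNReal.ofReal (‖deriv f z‖ ^ p * (1 - ‖z‖) ^ (γ + p)) :=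
        setLIntegral_density _ _ _ _
    _ ≤ ∫⁻ z in disk ∩ ball η s, ENNReal.ofReal C *
          (ψ z * ∫⁻ w in {w | (z, w) ∈ R}, density p γ f w) := setLIntegral_mono' hms hpt
    _ ≤ ∫⁻ z, ENNReal.ofReal C * (ψ z * ∫⁻ w in {w | (z, w) ∈ R}, density p γ f w) :=
        setLIntegral_le_lintegral _ _
    _ = ENNReal.ofReal C * ∫⁻ w, density p γ f w * ∫⁻ z in {z | (z, w) ∈ R}, ψ z := by
        rw [lintegral_const_mul' _ _ ENNReal.ofReal_ne_top,
          lintegral_mul_setLIntegral_swap hφm hψm hRm]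
    _ ≤ ENNReal.ofReal C * ∫⁻ w, (ball η (2 * s)).indicator
          (fun w => ENNReal.ofReal (9 / 4 * Real.pi) * density p γ f w) w := by
        gcongr with w; exact hin w
    _ = ENNReal.ofReal C * (ENNReal.ofReal (9 / 4 * Real.pi) *
          ∫⁻ w in ball η (2 * s), density p γ f w) := by
        rw [lintegral_indicator measurableSet_ball, lintegral_const_mul' _ _ ENNReal.ofReal_ne_top]
    _ ≤ ENNReal.ofReal C * (ENNReal.ofReal (9 / 4 * Real.pi) *
          ENNReal.ofReal (2 ^ a * ω s * (2 * s))) := by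
        gcongr
        refine (hcb η hη (2 * s) (by positivity)).trans (ENNReal.ofReal_le_ofReal ?_)
        gcongr
        exact hω.apply_mul_le (by norm_num) hs
    _ = _ := by
        rw [← ENNReal.ofReal_mul (by positivity), ← ENNReal.ofReal_mul (by positivity)]
        congr 1; ring

/-! ### Integration of Carleson bounds -/

theorem integral_mul_one_sub_mul_rpow {r b : ℝ} (hr : r ∈ Ico 0 1) (hb : 0 < b) :
    IntervalIntegrable (fun t => r * (1 - t * r) ^ (-b - 1)) volume 0 1 ∧
      ∫ t in (0 : ℝ)..1, r * (1 - t * r) ^ (-b - 1) = ((1 - r) ^ (-b) - 1) / b := by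
  have hpos : ∀ t ∈ uIcc (0 : ℝ) 1, 0 < 1 - t * r := by
    intro t ht
    rw [uIcc_of_le zero_le_one] at ht
    nlinarith [ht.1, ht.2, hr.1, hr.2]
  have hint : IntervalIntegrable (fun t => r * (1 - t * r) ^ (-b - 1)) volume 0 1 := by
    refine ContinuousOn.intervalIntegrable (continuousOn_const.mul
      (ContinuousOn.rpow_const (by fun_prop) fun t ht => Or.inl (hpos t ht).ne'))
  refine ⟨hint, ?_⟩
  have hd : ∀ t ∈ uIcc (0 : ℝ) 1,
      HasDerivAt (fun t => (1 - t * r) ^ (-b) / b) (r * (1 - t * r) ^ (-b - 1)) t := by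
    intro t ht
    have h1 : HasDerivAt (fun t => 1 - t * r) (-r) t := by
      simpa using ((hasDerivAt_id t).mul_const r).const_sub 1
    have h2 := (h1.rpow_const (p := -b) (Or.inl (hpos t ht).ne')).div_const b
    refine h2.congr_deriv ?_
    rw [div_eq_iff hb.ne']
    ring
  rw [intervalIntegral.integral_eq_sub_of_hasDerivAt hd hint]
  simp only [one_mul, zero_mul, sub_zero, Real.one_rpow]
  ring

theorem norm_integrationOp_le {h : ℂ → ℂ} {z : ℂ} (hz : z ∈ disk) {X b : ℝ} (hb : 0 < b)
    (hX : ∀ t ∈ Icc (0 : ℝ) 1, ‖h ((t : ℂ) * z)‖ ≤ X * (1 - t * ‖z‖) ^ (-b - 1)) (hX0 : 0 ≤ X) :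
    ‖integrationOp h z‖ ≤ X * (1 - ‖z‖) ^ (-b) / b := by
  obtain ⟨hint, heq⟩ := integral_mul_one_sub_mul_rpow (r := ‖z‖) ⟨norm_nonneg z, mem_disk.1 hz⟩ hb
  have h1 : ‖integrationOp h z‖ ≤
      ∫ t in (0 : ℝ)..1, X * (‖z‖ * (1 - t * ‖z‖) ^ (-b - 1)) := by
    refine intervalIntegral.norm_integral_le_of_norm_le zero_le_one ?_ (hint.const_mul X)
    refine Filter.Eventually.of_forall fun t ht => ?_
    rw [norm_mul]
    have := mul_le_mul_of_nonneg_right (hX t (Ioc_subset_Icc_self ht)) (norm_nonneg z)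
    linarith
  rw [intervalIntegral.integral_const_mul, heq] at h1
  refine h1.trans ?_
  rw [mul_div_assoc]
  gcongr
  linarith

/-- Along the segment from `0` to a point `z` near `η`, the growth of `h` is controlled by the gauge
at scale `s` and the mass of `h` above `z`. -/
theorem exists_rpow_norm_segment_le {q : ℝ} (hq : 0 < q) (γ a : ℝ) :
    ∃ C : ℝ, 0 < C ∧ ∀ h ∈ analyticOnDisk, ∀ ω, IsGauge a ω → CarlesonBound q (γ + q) h ω →
      ∀ η : ℂ, ‖η‖ = 1 → ∀ s : ℝ, 0 < s → ∀ z ∈ disk ∩ ball η s, ∀ t ∈ Icc (0 : ℝ) 1,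
        ENNReal.ofReal (‖h ((t : ℂ) * z)‖ ^ q * (1 - t * ‖z‖) ^ (γ + q + 1 - a)) ≤
          ENNReal.ofReal C * (ENNReal.ofReal (ω s * s ^ (-a)) +
            ∫⁻ w in {w | ‖z - w‖ < 4 * (1 - ‖w‖)},
              (ball η (3 * s)).indicator (density q (γ + q - a - 1) h) w) := by
  obtain ⟨C₁, hC₁, hgrowth⟩ := exists_growth_of_carlesonBound hq (γ + q) a
  obtain ⟨C₂, hC₂, hlocal⟩ := exists_rpow_norm_le_lintegral_density hq (γ + q - a - 1)
  refine ⟨C₁ + C₂, by positivity, fun h hh ω hω hcb η hη s hs z hz t ht => ?_⟩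
  have hz1 := mem_disk.1 hz.1
  have hnorm : ‖(t : ℂ) * z‖ = t * ‖z‖ := by
    rw [norm_mul, Complex.norm_real, Real.norm_of_nonneg ht.1]
  have htz : t * ‖z‖ ≤ ‖z‖ := mul_le_of_le_one_left (norm_nonneg z) ht.2
  have hξ : (t : ℂ) * z ∈ disk := by rw [mem_disk, hnorm]; linarith
  rw [← hnorm]
  have hξz : ‖z - (t : ℂ) * z‖ ≤ 1 - t * ‖z‖ := by
    have : z - (t : ℂ) * z = ((1 - t : ℝ) : ℂ) * z := by push_cast; ring
    rw [this, norm_mul, Complex.norm_real, Real.norm_of_nonneg (by linarith [ht.2])]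
    linarith
  rw [← hnorm] at hξz
  have hg := hgrowth h hh ω hω hcb _ hξ
  have hl := hlocal h hh _ hξ _ (mem_closedBall_self (by have := mem_disk.1 hξ; linarith))
  have hξ1 := mem_disk.1 hξ
  set ξ := (t : ℂ) * z
  set d := 1 - ‖ξ‖ with hd
  have hd0 : 0 < d := by linarith
  have hωs := hω.nonneg s hs
  -- Points of the segment at depth at least `s` are handled by growth, the gauge carrying `ω d`
  -- back to scale `s`. Deeper into the boundary layer the local mass is used, and it lies in a
  -- fixed region over `z`. The factor with exponent `-a` makes the right-hand side independent of
  -- `t`.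
  rcases le_or_gt s d with hsd | hsd
  · have h1 : ‖h ξ‖ ^ q * d ^ (γ + q + 1 - a) ≤ C₁ * (ω s * s ^ (-a)) := by
      have h2 := hω.le_rpow_mul s d hs hsd
      rw [Real.div_rpow hd0.le hs.le] at h2
      have h3 : 0 < d ^ a := by positivity
      have h4 : 0 < s ^ a := by positivity
      rw [Real.rpow_sub hd0, Real.rpow_neg hs.le, ← mul_div_assoc, div_le_iff₀ h3]
      calc _ ≤ C₁ * ω d := hg
        _ ≤ C₁ * (d ^ a / s ^ a * ω s) := by gcongr
        _ = _ := by ring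
    calc _ ≤ ENNReal.ofReal (C₁ * (ω s * s ^ (-a))) := ENNReal.ofReal_le_ofReal h1
      _ = ENNReal.ofReal C₁ * ENNReal.ofReal (ω s * s ^ (-a)) := ENNReal.ofReal_mul hC₁.le
      _ ≤ _ := by
        gcongr
        · linarith
        · exact le_self_add
  · have hexp : γ + q - a - 1 + 2 = γ + q + 1 - a := by ring
    rw [hexp] at hl
    have hsub : ball ξ (d / 2) ⊆ {w | ‖z - w‖ < 4 * (1 - ‖w‖)} ∩ ball η (3 * s) := by
      intro w hw
      rw [mem_ball, dist_eq_norm] at hw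
      have hzη := hz.2
      rw [mem_ball, dist_eq_norm] at hzη
      have h1 := norm_le_insert' w ξ
      have h2 := norm_sub_le_norm_sub_add_norm_sub z ξ w
      have h3 := norm_sub_le_norm_sub_add_norm_sub w z η
      rw [norm_sub_rev ξ w] at h2
      rw [norm_sub_rev w z] at h3
      refine ⟨?_, ?_⟩
      · change ‖z - w‖ < 4 * (1 - ‖w‖)
        linarith
      · rw [mem_ball, dist_eq_norm]
        linarith
    refine hl.trans ?_
    gcongr
    · linarith
    · refine le_trans ?_ le_add_self
      rw [setLIntegral_indicator measurableSet_ball, inter_comm]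
      exact lintegral_mono_set hsub

/-- The segment bound has the form `X * (1 - t * ‖z‖) ^ (-b - 1)` with `b = (γ + 1 - a) / q`. The
condition `a < γ + 1` gives `b > 0`, so integrating along the segment gains a full power. -/
theorem exists_rpow_norm_integrationOp_le {q : ℝ} (hq : 0 < q) {γ a : ℝ} (haγ : a < γ + 1) :
    ∃ C : ℝ, 0 < C ∧ ∀ h ∈ analyticOnDisk, ∀ ω, IsGauge a ω → CarlesonBound q (γ + q) h ω →
      ∀ η : ℂ, ‖η‖ = 1 → ∀ s : ℝ, 0 < s → ∀ z ∈ disk ∩ ball η s,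
        ENNReal.ofReal (‖integrationOp h z‖ ^ q * (1 - ‖z‖) ^ (γ + 1 - a)) ≤
          ENNReal.ofReal C * (ENNReal.ofReal (ω s * s ^ (-a)) +
            ∫⁻ w in {w | ‖z - w‖ < 4 * (1 - ‖w‖)},
              (ball η (3 * s)).indicator (density q (γ + q - a - 1) h) w) := by
  obtain ⟨C, hC, hseg⟩ := exists_rpow_norm_segment_le hq γ a
  set b : ℝ := (γ + 1 - a) / q with hb
  have hb0 : 0 < b := div_pos (by linarith) hq
  have hbq : b * q = γ + 1 - a := div_mul_cancel₀ _ hq.ne'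
  refine ⟨C / b ^ q, by positivity, fun h hh ω hω hcb η hη s hs z hz => ?_⟩
  have h1 := hseg h hh ω hω hcb η hη s hs z hz
  have hz1 := mem_disk.1 hz.1
  set S := ENNReal.ofReal (ω s * s ^ (-a)) + ∫⁻ w in {w | ‖z - w‖ < 4 * (1 - ‖w‖)},
              (ball η (3 * s)).indicator (density q (γ + q - a - 1) h) w
  rcases eq_or_ne S ⊤ with hST | hST
  · rw [hST, ENNReal.mul_top (by positivity)]; exact le_top
  rw [← ENNReal.ofReal_toReal hST, ← ENNReal.ofReal_mul (by positivity)]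
  apply ENNReal.ofReal_le_ofReal
  have h2 : ∀ t ∈ Icc (0 : ℝ) 1,
      ‖h ((t : ℂ) * z)‖ ≤ (C * S.toReal) ^ (1 / q) * (1 - t * ‖z‖) ^ (-b - 1) := by
    intro t ht
    have htz : t * ‖z‖ ≤ ‖z‖ := mul_le_of_le_one_left (norm_nonneg z) ht.2
    have hd : 0 < 1 - t * ‖z‖ := by linarith
    have h3 := h1 t ht
    rw [← ENNReal.ofReal_toReal hST, ← ENNReal.ofReal_mul hC.le,
      ENNReal.ofReal_le_ofReal_iff (by positivity), ← le_div_iff₀ (by positivity),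
      ← Real.le_rpow_inv_iff_of_pos (norm_nonneg _) (by positivity) hq,
      Real.div_rpow (by positivity) (by positivity), ← Real.rpow_mul hd.le] at h3
    refine h3.trans (le_of_eq ?_)
    rw [div_eq_mul_inv, ← Real.rpow_neg hd.le, one_div]
    congr 2
    rw [hb]; field_simp; ring
  have h3 := norm_integrationOp_le hz.1 hb0 h2 (by positivity)
  have hd : 0 < 1 - ‖z‖ := by linarith
  have h4 := Real.rpow_le_rpow (norm_nonneg _) h3 hq.le
  rw [Real.div_rpow (by positivity) hb0.le, Real.mul_rpow (by positivity) (by positivity), one_div,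
    Real.rpow_inv_rpow (by positivity) hq.ne', ← Real.rpow_mul hd.le, neg_mul, hbq,
    Real.rpow_neg hd.le] at h4
  have h5 : 0 < (1 - ‖z‖) ^ (γ + 1 - a) := by positivity
  calc _ ≤ C * S.toReal * ((1 - ‖z‖) ^ (γ + 1 - a))⁻¹ / b ^ q * (1 - ‖z‖) ^ (γ + 1 - a) := by gcongr
    _ = _ := by field_simp

/-- Integration from the origin lowers the weight in a Carleson bound by `q`. -/
theorem exists_carlesonBound_integrationOp {q : ℝ} (hq : 0 < q) {γ a : ℝ} (ha : 0 < a)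
    (haγ : a < γ + 1) :
    ∃ C : ℝ, 0 < C ∧ ∀ h ∈ analyticOnDisk, ∀ ω, IsGauge a ω → CarlesonBound q (γ + q) h ω →
      CarlesonBound q γ (integrationOp h) fun s => C * ω s := by
  obtain ⟨C, hC, hpt⟩ := exists_rpow_norm_integrationOp_le hq haγ
  have hpi := Real.pi_pos
  set V : ℝ := 2 * Real.pi / (a - 1 + 1) with hV
  have hV0 : 0 < V := by rw [hV, sub_add_cancel]; positivity
  refine ⟨C * (V + V * 5 ^ (a + 1) * 3 ^ a * 3), by positivity,
    fun h hh ω hω hcb η hη s hs => ?_⟩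
  have hωs := hω.nonneg s hs
  have hvol : ∀ η : ℂ, ‖η‖ = 1 → ∀ s : ℝ, 0 < s →
      ∫⁻ z in disk ∩ ball η s, ENNReal.ofReal ((1 - ‖z‖) ^ (a - 1)) ≤
        ENNReal.ofReal (V * s ^ (a + 1)) := by
    intro η hη s hs
    have := lintegral_disk_inter_ball_rpow_le (c := a - 1) (by linarith) hs hη
    rwa [show a - 1 + 2 = a + 1 by ring] at this
  -- For fixed `w` in the disk, the related `z` lie in a boundary ball of radius `5 * (1 - ‖w‖)`.
  -- The weight `(1 - ‖z‖) ^ (a - 1)`, integrable because `0 < a`, has mass of order `(1 - ‖w‖) ^ (a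
  -- + 1)` there, which restores the exponent `γ + q`.
  set R : Set (ℂ × ℂ) := {x | ‖x.1 - x.2‖ < 4 * (1 - ‖x.2‖)} with hR
  have hRm : MeasurableSet R := measurableSet_lt (by fun_prop) (by fun_prop)
  set ψ : ℂ → ℝ≥0∞ :=
    (disk ∩ ball η s).indicator fun z => ENNReal.ofReal ((1 - ‖z‖) ^ (a - 1)) with hψ
  have hψm : Measurable ψ := measurable_indicator_disk_inter_ball_rpow η s (a - 1)
  have hms : MeasurableSet (disk ∩ ball η s) := isOpen_disk.measurableSet.inter measurableSet_ball
  set φ : ℂ → ℝ≥0∞ := (ball η (3 * s)).indicator (density q (γ + q - a - 1) h) with hφ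
  have hφm : Measurable φ :=
    (measurable_density hq _ (DifferentiableOn.continuousOn hh)).indicator measurableSet_ball
  have hin : ∀ w, φ w * ∫⁻ z in {z | (z, w) ∈ R}, ψ z ≤
      (ball η (3 * s)).indicator
        (fun w => ENNReal.ofReal (V * 5 ^ (a + 1)) * density q (γ + q) h w) w := by
    intro w
    by_cases hw : w ∈ ball η (3 * s)
    swap
    · simp [hφ, hw]
    rw [hφ, indicator_of_mem hw, indicator_of_mem hw]
    by_cases hwd : w ∈ disk
    swap
    · simp [density, hwd]
    have hw1 := mem_disk.1 hwd
    obtain ⟨ηw, hηw, hwη⟩ := exists_norm_eq_one_norm_sub_eq w hwd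
    set d := 1 - ‖w‖ with hd
    have hd0 : 0 < d := by linarith
    have h1 : ∫⁻ z in {z | (z, w) ∈ R}, ψ z ≤ ENNReal.ofReal (V * (5 * d) ^ (a + 1)) := by
      calc ∫⁻ z in {z | (z, w) ∈ R}, ψ z ≤ ∫⁻ z in ball ηw (5 * d), ψ z := by
            refine lintegral_mono_set fun z hz => ?_
            have hz' : ‖z - w‖ < 4 * d := hz
            rw [mem_ball, dist_eq_norm]
            have h3 := norm_sub_le_norm_sub_add_norm_sub z w ηw
            linarith
        _ ≤ ∫⁻ z in ball ηw (5 * d),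
              disk.indicator (fun z => ENNReal.ofReal ((1 - ‖z‖) ^ (a - 1))) z :=
            lintegral_mono fun z => indicator_le_indicator_of_subset inter_subset_left
              (fun _ => zero_le) z
        _ = ∫⁻ z in disk ∩ ball ηw (5 * d), ENNReal.ofReal ((1 - ‖z‖) ^ (a - 1)) :=
            setLIntegral_indicator isOpen_disk.measurableSet _
        _ ≤ _ := hvol ηw hηw _ (by positivity)
    refine (mul_le_mul_right h1 _).trans (le_of_eq ?_)
    rw [density, density, indicator_of_mem hwd, indicator_of_mem hwd,
      ← ENNReal.ofReal_mul (by positivity), ← ENNReal.ofReal_mul (by positivity)]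
    have hsplit : d ^ (γ + q) = d ^ (γ + q - a - 1) * d ^ (a + 1) := by
      rw [← Real.rpow_add hd0]; congr 1; ring
    rw [← hd, Real.mul_rpow (by norm_num) hd0.le, hsplit]
    congr 1
    ring
  have hmain : ∀ z ∈ disk ∩ ball η s,
      ENNReal.ofReal (‖integrationOp h z‖ ^ q * (1 - ‖z‖) ^ γ) ≤
        ENNReal.ofReal C * (ENNReal.ofReal (ω s * s ^ (-a)) * ψ z +
          ψ z * ∫⁻ w in {w | (z, w) ∈ R}, φ w) := by
    intro z hz
    have hz1 := mem_disk.1 hz.1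
    have hd0 : 0 < 1 - ‖z‖ := by linarith
    have h1 := hpt h hh ω hω hcb η hη s hs z hz
    rw [hψ, indicator_of_mem hz]
    calc ENNReal.ofReal (‖integrationOp h z‖ ^ q * (1 - ‖z‖) ^ γ)
        = ENNReal.ofReal ((1 - ‖z‖) ^ (a - 1)) *
          ENNReal.ofReal (‖integrationOp h z‖ ^ q * (1 - ‖z‖) ^ (γ + 1 - a)) := by
          rw [← ENNReal.ofReal_mul (by positivity), mul_left_comm, ← Real.rpow_add hd0]
          congr 3; ring
      _ ≤ ENNReal.ofReal ((1 - ‖z‖) ^ (a - 1)) * _ := mul_le_mul_right h1 _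
      _ = _ := by
          rw [mul_left_comm, mul_add, mul_comm (ENNReal.ofReal (ω s * s ^ (-a)))]
          rfl
  have hψint : ∫⁻ z, ψ z ≤ ENNReal.ofReal (V * s ^ (a + 1)) := by
    rw [hψ, lintegral_indicator hms]
    exact hvol η hη s hs
  calc ∫⁻ z in ball η s, density q γ (integrationOp h) z
      = ∫⁻ z in disk ∩ ball η s, ENNReal.ofReal (‖integrationOp h z‖ ^ q * (1 - ‖z‖) ^ γ) :=
        setLIntegral_density _ _ _ _
    _ ≤ ∫⁻ z in disk ∩ ball η s, ENNReal.ofReal C * (ENNReal.ofReal (ω s * s ^ (-a)) * ψ z +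
          ψ z * ∫⁻ w in {w | (z, w) ∈ R}, φ w) := setLIntegral_mono' hms hmain
    _ ≤ ∫⁻ z, ENNReal.ofReal C * (ENNReal.ofReal (ω s * s ^ (-a)) * ψ z +
          ψ z * ∫⁻ w in {w | (z, w) ∈ R}, φ w) := setLIntegral_le_lintegral _ _
    _ = ENNReal.ofReal C * (ENNReal.ofReal (ω s * s ^ (-a)) * (∫⁻ z, ψ z) +
          ∫⁻ w, φ w * ∫⁻ z in {z | (z, w) ∈ R}, ψ z) := by
        rw [lintegral_const_mul' _ _ ENNReal.ofReal_ne_top, lintegral_add_left (hψm.const_mul _),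
          lintegral_const_mul' _ _ ENNReal.ofReal_ne_top,
          lintegral_mul_setLIntegral_swap hφm hψm hRm]
    _ ≤ ENNReal.ofReal C * (ENNReal.ofReal (ω s * s ^ (-a)) * ENNReal.ofReal (V * s ^ (a + 1)) +
          ∫⁻ w, (ball η (3 * s)).indicator
            (fun w => ENNReal.ofReal (V * 5 ^ (a + 1)) * density q (γ + q) h w) w) := by
        gcongr with w
        exact hin w
    _ = ENNReal.ofReal C * (ENNReal.ofReal (ω s * s ^ (-a)) * ENNReal.ofReal (V * s ^ (a + 1)) +
          ENNReal.ofReal (V * 5 ^ (a + 1)) * ∫⁻ w in ball η (3 * s), density q (γ + q) h w) := by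
        rw [lintegral_indicator measurableSet_ball, lintegral_const_mul' _ _ ENNReal.ofReal_ne_top]
    _ ≤ ENNReal.ofReal C * (ENNReal.ofReal (ω s * s ^ (-a)) * ENNReal.ofReal (V * s ^ (a + 1)) +
          ENNReal.ofReal (V * 5 ^ (a + 1)) * ENNReal.ofReal (3 ^ a * ω s * (3 * s))) := by
        gcongr
        refine (hcb η hη (3 * s) (by positivity)).trans (ENNReal.ofReal_le_ofReal ?_)
        gcongr
        exact hω.apply_mul_le (by norm_num) hs
    _ = _ := by
        rw [← ENNReal.ofReal_mul (by positivity), ← ENNReal.ofReal_mul (by positivity),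
          ← ENNReal.ofReal_add (by positivity) (by positivity), ← ENNReal.ofReal_mul (by positivity)]
        congr 1
        rw [Real.rpow_neg hs.le, Real.rpow_add_one hs.ne']
        have : 0 < s ^ a := by positivity
        field_simp

/-! ### Carleson boxes, boundary balls and the tent quasi-norm -/

/-- The ball subtends an angle of at most `π * s` on either side of `η`, while the box at depth `8 *
s` allows `4 * s`. -/
theorem disk_inter_ball_subset_carlesonBox {η : ℂ} (hη : ‖η‖ = 1) {s : ℝ} (hs : 0 < s)
    (hs8 : 8 * s < 1) :
    disk ∩ ball η s ⊆ carlesonBox (((1 - 8 * s : ℝ) : ℂ) * η) := by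
  intro w hw
  have hη0 : η ≠ 0 := by rintro rfl; simp at hη
  have hw1 := mem_disk.1 hw.1
  have hwη := hw.2
  rw [mem_ball, dist_eq_norm] at hwη
  have hr : 0 < 1 - 8 * s := by linarith
  have hu : ((1 - 8 * s : ℝ) : ℂ) * η ≠ 0 := mul_ne_zero (by exact_mod_cast hr.ne') hη0
  have hnu : ‖((1 - 8 * s : ℝ) : ℂ) * η‖ = 1 - 8 * s := by
    rw [norm_mul, Complex.norm_real, Real.norm_of_nonneg hr.le, hη, mul_one]
  have hws : 1 - s < ‖w‖ := by
    have := one_sub_norm_le_of_norm_eq_one (z := w) hη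
    linarith
  have hnw : ‖w / η‖ = ‖w‖ := by rw [norm_div, hη, div_one]
  have hpolar : ((‖w‖ : ℝ) : ℂ) * Complex.exp ((w / η).arg * Complex.I) = w / η := by
    have := Complex.norm_mul_exp_arg_mul_I (w / η)
    rwa [hnw] at this
  have hpolarη : Complex.exp (η.arg * Complex.I) = η := by
    have := Complex.norm_mul_exp_arg_mul_I η
    rwa [hη, Complex.ofReal_one, one_mul] at this
  have harg : |(w / η).arg| ≤ Real.pi * s := by
    refine abs_le_pi_mul_of_norm_sub_one_lt ⟨by linarith, hw1⟩ (Complex.abs_arg_le_pi _) ?_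
    rw [hpolar, div_sub_one hη0, norm_div, hη, div_one]
    exact hwη
  rw [carlesonBox, if_neg hu]
  -- The box accepts any real angle representing `w`, so this sum may leave the principal branch.
  refine ⟨hw.1, ‖w‖, η.arg + (w / η).arg, ?_, ?_, ?_⟩
  · rw [Complex.ofReal_add, add_mul, Complex.exp_add, hpolarη, mul_left_comm, hpolar,
      mul_div_cancel₀ _ hη0]
  · rw [Complex.arg_real_mul _ hr, hnu, add_sub_cancel_left]
    have := Real.pi_lt_d2
    nlinarith
  · rw [hnu]; linarith

theorem exists_carlesonBox_subset {u : ℂ} (hu : u ∈ disk) :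
    ∃ η : ℂ, ‖η‖ = 1 ∧ carlesonBox u ⊆ disk ∩ ball η (2 * (1 - ‖u‖)) := by
  have hu1 := mem_disk.1 hu
  rcases eq_or_ne u 0 with rfl | hu0
  · refine ⟨1, by simp, fun w hw => ?_⟩
    rw [carlesonBox, if_pos rfl] at hw
    refine ⟨hw, ?_⟩
    have hw1 := mem_disk.1 hw
    rw [mem_ball, dist_eq_norm, norm_zero]
    have := norm_sub_le w 1
    rw [norm_one] at this
    linarith
  · refine ⟨Complex.exp (u.arg * Complex.I), Complex.norm_exp_ofReal_mul_I _, fun w hw => ?_⟩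
    rw [carlesonBox, if_neg hu0] at hw
    obtain ⟨hwd, r, t, hwrt, ht, hr⟩ := hw
    refine ⟨hwd, ?_⟩
    have hw1 := mem_disk.1 hwd
    have hr0 : 0 < r := by have := norm_pos_iff.2 hu0; linarith
    have hnw : ‖w‖ = r := by
      rw [hwrt, norm_mul, Complex.norm_exp_ofReal_mul_I, Complex.norm_real,
        Real.norm_of_nonneg hr0.le, mul_one]
    have hsplit : w - Complex.exp (u.arg * Complex.I) =
        -(((1 - r : ℝ) : ℂ) * Complex.exp (t * Complex.I)) +
          Complex.exp (u.arg * Complex.I) *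
            (Complex.exp (Complex.I * ((t - u.arg : ℝ) : ℂ)) - 1) := by
      have : Complex.exp (t * Complex.I) = Complex.exp (u.arg * Complex.I) *
          Complex.exp (Complex.I * ((t - u.arg : ℝ) : ℂ)) := by
        rw [← Complex.exp_add]; congr 1; push_cast; ring
      rw [hwrt, this]; push_cast; ring
    have h1 := Real.norm_exp_I_mul_ofReal_sub_one_le (x := t - u.arg)
    rw [Real.norm_eq_abs] at h1
    rw [mem_ball, dist_eq_norm, hsplit]
    refine (norm_add_le _ _).trans_lt ?_
    rw [norm_neg, norm_mul, norm_mul, Complex.norm_exp_ofReal_mul_I, Complex.norm_exp_ofReal_mul_I,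
      Complex.norm_real, Real.norm_of_nonneg (by linarith)]
    linarith

theorem one_sub_sq_rpow_le {z : ℂ} (hz : z ∈ disk) (γ : ℝ) :
    (1 - ‖z‖ ^ 2) ^ γ ≤ 2 ^ |γ| * (1 - ‖z‖) ^ γ ∧
      (1 - ‖z‖) ^ γ ≤ 2 ^ |γ| * (1 - ‖z‖ ^ 2) ^ γ := by
  have hz1 := mem_disk.1 hz
  have hn := norm_nonneg z
  have h1 : 0 < 1 - ‖z‖ ^ 2 := by nlinarith
  have h2 : 0 < 1 - ‖z‖ := by linarith
  exact ⟨rpow_le_rpow_of_comparable γ h1 h2 two_pos (by nlinarith) (by nlinarith),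
    rpow_le_rpow_of_comparable γ h2 h1 two_pos (by nlinarith) (by nlinarith)⟩

theorem boxAverage_eq (p α : ℝ) (f : ℂ → ℂ) (u : ℂ) :
    boxAverage p α f u = ENNReal.ofReal (1 / (1 - ‖u‖ ^ 2)) * (ENNReal.ofReal (1 / Real.pi) *
      ∫⁻ z in carlesonBox u, ENNReal.ofReal (‖f z‖ ^ p * (1 - ‖z‖ ^ 2) ^ (α + 1))) := by
  rw [boxAverage, areaMeasure, setLIntegral_smul_measure, smul_eq_mul]

theorem boxAverage_le_of_carlesonBound {p α : ℝ} {f : ℂ → ℂ} {ω : ℝ → ℝ}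
    (hω : ∀ s, 0 < s → 0 ≤ ω s) (h : CarlesonBound p (α + 1) f ω) {u : ℂ} (hu : u ∈ disk) :
    boxAverage p α f u ≤ ENNReal.ofReal (2 ^ (|α + 1| + 1) * ω (2 * (1 - ‖u‖))) := by
  have hpi := Real.pi_pos
  have hu1 := mem_disk.1 hu
  have hn := norm_nonneg u
  obtain ⟨η, hη, hsub⟩ := exists_carlesonBox_subset hu
  set d := 1 - ‖u‖ with hd
  have hd0 : 0 < d := by linarith
  have hωd := hω (2 * d) (by positivity)
  have hd2 : d ≤ 1 - ‖u‖ ^ 2 := by nlinarith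
  have hms : MeasurableSet (disk ∩ ball η (2 * d)) :=
    isOpen_disk.measurableSet.inter measurableSet_ball
  have h1 : ∫⁻ z in carlesonBox u, ENNReal.ofReal (‖f z‖ ^ p * (1 - ‖z‖ ^ 2) ^ (α + 1)) ≤
      ENNReal.ofReal (2 ^ |α + 1| * (ω (2 * d) * (2 * d))) := by
    calc _ ≤ ∫⁻ z in disk ∩ ball η (2 * d),
          ENNReal.ofReal (‖f z‖ ^ p * (1 - ‖z‖ ^ 2) ^ (α + 1)) := lintegral_mono_set hsub
      _ ≤ ∫⁻ z in disk ∩ ball η (2 * d), ENNReal.ofReal (2 ^ |α + 1|) *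
          ENNReal.ofReal (‖f z‖ ^ p * (1 - ‖z‖) ^ (α + 1)) := by
        refine setLIntegral_mono' hms fun z hz => ?_
        rw [← ENNReal.ofReal_mul (by positivity), mul_left_comm]
        apply ENNReal.ofReal_le_ofReal
        gcongr
        exact (one_sub_sq_rpow_le hz.1 _).1
      _ = ENNReal.ofReal (2 ^ |α + 1|) * ∫⁻ z in ball η (2 * d), density p (α + 1) f z := by
        rw [lintegral_const_mul' _ _ ENNReal.ofReal_ne_top, setLIntegral_density]
      _ ≤ _ := by
        rw [ENNReal.ofReal_mul (by positivity)]
        gcongr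
        exact h η hη _ (by positivity)
  rw [boxAverage_eq]
  calc _ ≤ ENNReal.ofReal (1 / d) * (ENNReal.ofReal 1 *
        ENNReal.ofReal (2 ^ |α + 1| * (ω (2 * d) * (2 * d)))) := by
        gcongr
        rw [div_le_one hpi]
        linarith [Real.pi_gt_three]
    _ = _ := by
        rw [← ENNReal.ofReal_mul (by positivity), ← ENNReal.ofReal_mul (by positivity),
          Real.rpow_add_one two_ne_zero]
        congr 1
        field_simp

theorem lintegral_density_le_boxAverage {p α : ℝ} {f : ℂ → ℂ} {η : ℂ} (hη : ‖η‖ = 1) {s : ℝ}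
    (hs : 0 < s) (hs8 : 8 * s < 1) :
    ∫⁻ z in ball η s, density p (α + 1) f z ≤
      ENNReal.ofReal (2 ^ |α + 1| * Real.pi * 16 * s) *
        boxAverage p α f (((1 - 8 * s : ℝ) : ℂ) * η) := by
  have hpi := Real.pi_pos
  have hr : 0 < 1 - 8 * s := by linarith
  set u : ℂ := ((1 - 8 * s : ℝ) : ℂ) * η with hu
  have hnu : ‖u‖ = 1 - 8 * s := by
    rw [hu, norm_mul, Complex.norm_real, Real.norm_of_nonneg hr.le, hη, mul_one]
  have hms : MeasurableSet (disk ∩ ball η s) :=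
    isOpen_disk.measurableSet.inter measurableSet_ball
  have hu2 : 0 < 1 - ‖u‖ ^ 2 := by rw [hnu]; nlinarith
  set J := ∫⁻ z in carlesonBox u, ENNReal.ofReal (‖f z‖ ^ p * (1 - ‖z‖ ^ 2) ^ (α + 1)) with hJ
  have hbox : J = ENNReal.ofReal (Real.pi * (1 - ‖u‖ ^ 2)) * boxAverage p α f u := by
    rw [boxAverage_eq, ← mul_assoc, ← mul_assoc, ← ENNReal.ofReal_mul (by positivity),
      ← ENNReal.ofReal_mul (by positivity)]
    rw [show Real.pi * (1 - ‖u‖ ^ 2) * (1 / (1 - ‖u‖ ^ 2)) * (1 / Real.pi) = 1 by field_simp]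
    simp [hJ]
  rw [setLIntegral_density]
  calc _ ≤ ∫⁻ z in disk ∩ ball η s, ENNReal.ofReal (2 ^ |α + 1|) *
          ENNReal.ofReal (‖f z‖ ^ p * (1 - ‖z‖ ^ 2) ^ (α + 1)) := by
        refine setLIntegral_mono' hms fun z hz => ?_
        rw [← ENNReal.ofReal_mul (by positivity), mul_left_comm]
        apply ENNReal.ofReal_le_ofReal
        gcongr
        exact (one_sub_sq_rpow_le hz.1 _).2
    _ ≤ ENNReal.ofReal (2 ^ |α + 1|) * J := by
        rw [lintegral_const_mul' _ _ ENNReal.ofReal_ne_top]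
        exact mul_le_mul' le_rfl
          (lintegral_mono_set (disk_inter_ball_subset_carlesonBox hη hs hs8))
    _ ≤ _ := by
        rw [hbox, ← mul_assoc, ← ENNReal.ofReal_mul (by positivity)]
        refine mul_le_mul' (ENNReal.ofReal_le_ofReal ?_) le_rfl
        have h1 : 1 - ‖u‖ ^ 2 ≤ 16 * s := by rw [hnu]; nlinarith
        calc 2 ^ |α + 1| * (Real.pi * (1 - ‖u‖ ^ 2)) ≤ 2 ^ |α + 1| * (Real.pi * (16 * s)) := by
              gcongr
          _ = _ := by ring

/-- The angles whose region contains `u` form an open set, nonempty because `ζ * (1 + ‖u‖) > 1`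
admits the radial projection of `u`. Having positive measure, it meets the set where the essential
bound holds. If `ζ < 1`, points near `0` lie in no region, hence the restriction on `‖u‖`. -/
theorem boxAverage_le_tentNorm_rpow {ζ p α : ℝ} (hp : 0 < p) (hζ : 0 < ζ) {f : ℂ → ℂ} {u : ℂ}
    (hu : u ∈ disk) (huζ : 1 / ζ - 1 < ‖u‖) :
    boxAverage p α f u ≤ tentNorm ζ p α f ^ p := by
  have hpi := Real.pi_pos
  have hu1 := mem_disk.1 hu
  set V : Set ℝ := {θ | ‖u - Complex.exp (θ * Complex.I)‖ < ζ * (1 - ‖u‖ ^ 2)} with hV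
  have hVo : IsOpen V := isOpen_lt (by fun_prop) continuous_const
  have hmem : ∃ θ ∈ Ioc (0 : ℝ) (2 * Real.pi), θ ∈ V := by
    have hlt : 1 - ‖u‖ < ζ * (1 - ‖u‖ ^ 2) := by
      have h1 : 1 < ζ * (1 + ‖u‖) := by
        have := (div_lt_iff₀' hζ).1 (show 1 / ζ < 1 + ‖u‖ by linarith)
        exact this
      nlinarith
    have key : ∀ θ : ℝ, Complex.exp (θ * Complex.I) = Complex.exp (u.arg * Complex.I) → θ ∈ V := by
      intro θ hθ
      change ‖u - Complex.exp (θ * Complex.I)‖ < _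
      have h2 : u - Complex.exp (θ * Complex.I) =
          ((‖u‖ - 1 : ℝ) : ℂ) * Complex.exp (u.arg * Complex.I) := by
        rw [hθ]
        nth_rewrite 1 [← Complex.norm_mul_exp_arg_mul_I u]
        push_cast; ring
      rw [h2, norm_mul, Complex.norm_exp_ofReal_mul_I, Complex.norm_real, Real.norm_eq_abs,
        abs_of_neg (by linarith)]
      linarith
    rcases lt_or_ge 0 u.arg with h | h
    · exact ⟨u.arg, ⟨h, by linarith [Complex.arg_le_pi u]⟩, key _ rfl⟩
    · refine ⟨u.arg + 2 * Real.pi, ⟨by linarith [Complex.neg_pi_lt_arg u], by linarith⟩, key _ ?_⟩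
      push_cast
      rw [add_mul, Complex.exp_add, Complex.exp_two_pi_mul_I, mul_one]
  obtain ⟨θ₀, hθ₀, hθ₀V⟩ := hmem
  have hne : (V ∩ Ioo 0 (2 * Real.pi)).Nonempty := by
    have hcl : θ₀ ∈ closure (Ioo 0 (2 * Real.pi)) := by
      rw [closure_Ioo (by positivity)]; exact Ioc_subset_Icc_self hθ₀
    exact mem_closure_iff.1 hcl V hVo hθ₀V
  have hpos : 0 < volume (V ∩ Ioo 0 (2 * Real.pi)) := (hVo.inter isOpen_Ioo).measure_pos _ hne
  set F : ℝ → ℝ≥0∞ := fun θ =>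
    (⨆ v ∈ region ζ (Complex.exp ((θ : ℂ) * Complex.I)), boxAverage p α f v) ^ (1 / p) with hF
  have hae : ∀ᵐ θ ∂(volume.restrict (Ioc 0 (2 * Real.pi))), F θ ≤ tentNorm ζ p α f :=
    ENNReal.ae_le_essSup F
  have hex : ∃ θ ∈ V, F θ ≤ tentNorm ζ p α f := by
    by_contra! hcon
    have hz : (volume.restrict (Ioc 0 (2 * Real.pi))) V = 0 :=
      measure_mono_null (fun θ hθ => not_le.2 (hcon θ hθ)) (ae_iff.1 hae)
    rw [Measure.restrict_apply hVo.measurableSet] at hz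
    have := measure_mono_null (inter_subset_inter_right V Ioo_subset_Ioc_self) hz
    exact hpos.ne' this
  obtain ⟨θ, hθV, hθ⟩ := hex
  have h1 : boxAverage p α f u ≤
      ⨆ v ∈ region ζ (Complex.exp ((θ : ℂ) * Complex.I)), boxAverage p α f v :=
    le_iSup₂ (f := fun v (_ : v ∈ region ζ (Complex.exp ((θ : ℂ) * Complex.I))) =>
      boxAverage p α f v) u ⟨hu, hθV⟩
  refine h1.trans ?_
  rw [hF, one_div] at hθ
  exact (ENNReal.rpow_inv_le_iff hp).1 hθ

theorem tentNorm_le_of_boxAverage_le {ζ p α : ℝ} (hp : 0 < p) {f : ℂ → ℂ} {M : ℝ≥0∞}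
    (h : ∀ u ∈ disk, boxAverage p α f u ≤ M) : tentNorm ζ p α f ≤ M ^ (1 / p) := by
  refine essSup_le_of_ae_le _ (Filter.Eventually.of_forall fun θ => ?_)
  exact ENNReal.rpow_le_rpow (iSup₂_le fun u hu => h u hu.1) (by positivity)

/-! ### Tent spaces as Carleson bounds -/

/-- A bound for the mass near every boundary point at one fixed scale bounds the total mass. -/
theorem exists_lintegral_density_le {p γ s : ℝ} (hp : 0 < p) (hγ : -1 < γ) (hs : 0 < s)
    (hs1 : s < 1) :
    ∃ C : ℝ, 0 < C ∧ ∀ f ∈ analyticOnDisk, ∀ M : ℝ, 0 ≤ M →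
      (∀ η : ℂ, ‖η‖ = 1 → ∫⁻ z in ball η s, density p γ f z ≤ ENNReal.ofReal M) →
        ∫⁻ z, density p γ f z ≤ ENNReal.ofReal (C * M) := by
  have hpi := Real.pi_pos
  obtain ⟨C, hC, hloc⟩ := exists_rpow_norm_le_lintegral_density hp γ
  -- Finitely many balls of radius `s` cover the outer annulus. Inside, the local estimate bounds
  -- `f` on the circle of radius `1 - s / 4`, and the maximum principle carries the bound inward.
  obtain ⟨t, hts, htf, htc⟩ := (isCompact_sphere (0 : ℂ) 1).finite_cover_balls (half_pos hs)
  set K : ℝ := C * (s / 4) ^ (-(γ + 2)) with hK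
  have hK0 : 0 < K := by positivity
  set V : ℝ := 2 * Real.pi / (γ + 1) * 2 ^ (γ + 2) with hV
  have hV0 : 0 < V := by
    have : 0 < γ + 1 := by linarith
    positivity
  refine ⟨htf.toFinset.card + K * V, by positivity, fun f hf M hM h => ?_⟩
  have hinner : ∀ z ∈ closedBall (0 : ℂ) (1 - s / 2), ‖f z‖ ^ p ≤ K * M := by
    have hsphere : ∀ w ∈ sphere (0 : ℂ) (1 - s / 4), ‖f w‖ ≤ (K * M) ^ (1 / p) := by
      intro w hw
      rw [mem_sphere_zero_iff_norm] at hw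
      have hwd : w ∈ disk := by rw [mem_disk, hw]; linarith
      obtain ⟨η, hη, hηw⟩ := exists_norm_eq_one_norm_sub_eq w hwd
      have h1 := hloc f hf w hwd w (mem_closedBall_self (by rw [hw]; linarith))
      rw [hw] at hηw h1
      rw [sub_sub_cancel] at hηw h1
      have hsub : ball w (s / 4 / 2) ⊆ ball η s := by
        apply ball_subset_ball'
        rw [dist_eq_norm, hηw]; linarith
      have h2 : ENNReal.ofReal (‖f w‖ ^ p * (s / 4) ^ (γ + 2)) ≤ ENNReal.ofReal (C * M) := by
        rw [ENNReal.ofReal_mul hC.le]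
        refine h1.trans ?_
        gcongr
        exact (lintegral_mono_set hsub).trans (h η hη)
      rw [ENNReal.ofReal_le_ofReal_iff (by positivity)] at h2
      rw [one_div, Real.le_rpow_inv_iff_of_pos (norm_nonneg _) (by positivity) hp, hK,
        Real.rpow_neg (by positivity), mul_right_comm, ← div_eq_mul_inv, le_div_iff₀ (by positivity)]
      exact h2
    intro z hz
    have hsub : closedBall (0 : ℂ) (1 - s / 4) ⊆ disk := by
      intro x hx
      rw [mem_closedBall_zero_iff] at hx
      rw [mem_disk]; linarith
    have h1 : ‖f z‖ ≤ (K * M) ^ (1 / p) := by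
      have hr : 1 - s / 4 ≠ 0 := by linarith
      refine Complex.norm_le_of_forall_mem_frontier_norm_le (U := ball (0 : ℂ) (1 - s / 4))
        isBounded_ball ((DifferentiableOn.mono hf hsub).diffContOnCl_ball subset_rfl) ?_ ?_
      · rw [frontier_ball _ hr]; exact hsphere
      · rw [closure_ball _ hr]
        exact closedBall_subset_closedBall (by linarith) hz
    rwa [one_div, Real.le_rpow_inv_iff_of_pos (norm_nonneg _) (by positivity) hp] at h1
  have hcover : (univ : Set ℂ) ⊆
      (closedBall (0 : ℂ) (1 - s / 2) ∪ diskᶜ) ∪ ⋃ x : htf.toFinset, ball (x : ℂ) s := by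
    intro z _
    by_cases hzd : z ∈ disk
    swap
    · exact Or.inl (Or.inr hzd)
    rcases le_or_gt ‖z‖ (1 - s / 2) with hz | hz
    · exact Or.inl (Or.inl (mem_closedBall_zero_iff.2 hz))
    · right
      obtain ⟨η, hη, hηz⟩ := exists_norm_eq_one_norm_sub_eq z hzd
      have := htc (mem_sphere_zero_iff_norm.2 hη)
      simp only [mem_iUnion] at this
      obtain ⟨x, hx, hxη⟩ := this
      refine mem_iUnion.2 ⟨⟨x, htf.mem_toFinset.2 hx⟩, ?_⟩
      rw [mem_ball] at hxη ⊢
      have h1 := dist_triangle z η x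
      rw [dist_eq_norm z η, hηz] at h1
      linarith
  have hin : ∫⁻ z in closedBall (0 : ℂ) (1 - s / 2) ∪ diskᶜ, density p γ f z ≤
      ENNReal.ofReal (K * M * V) := by
    have hms : MeasurableSet (closedBall (0 : ℂ) (1 - s / 2) ∪ diskᶜ) :=
      measurableSet_closedBall.union isOpen_disk.measurableSet.compl
    calc _ ≤ ∫⁻ z in closedBall (0 : ℂ) (1 - s / 2) ∪ diskᶜ, ENNReal.ofReal (K * M) *
          disk.indicator (fun z => ENNReal.ofReal ((1 - ‖z‖) ^ γ)) z := by
          refine setLIntegral_mono' hms fun z hz => ?_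
          by_cases hzd : z ∈ disk
          · have hz1 := mem_disk.1 hzd
            have hd : 0 < 1 - ‖z‖ := by linarith
            rw [density, indicator_of_mem hzd, indicator_of_mem hzd,
              ← ENNReal.ofReal_mul (by positivity)]
            apply ENNReal.ofReal_le_ofReal
            gcongr
            exact hinner z (hz.resolve_right fun h => h hzd)
          · simp [density, hzd]
      _ ≤ ∫⁻ z, ENNReal.ofReal (K * M) *
          disk.indicator (fun z => ENNReal.ofReal ((1 - ‖z‖) ^ γ)) z := setLIntegral_le_lintegral _ _
      _ = ENNReal.ofReal (K * M) * ∫⁻ z in disk ∩ ball 1 2, ENNReal.ofReal ((1 - ‖z‖) ^ γ) := by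
          rw [lintegral_const_mul' _ _ ENNReal.ofReal_ne_top,
            lintegral_indicator isOpen_disk.measurableSet]
          congr 3
          rw [eq_comm, inter_eq_left]
          intro z hz
          rw [mem_disk] at hz
          rw [mem_ball, dist_eq_norm]
          have := norm_sub_le z 1
          rw [norm_one] at this
          linarith
      _ ≤ _ := by
          rw [ENNReal.ofReal_mul (p := K * M) (by positivity)]
          exact mul_le_mul' le_rfl (lintegral_disk_inter_ball_one_rpow_le hγ two_pos)
  have hout : ∫⁻ z in ⋃ x : htf.toFinset, ball (x : ℂ) s, density p γ f z ≤
      ENNReal.ofReal (htf.toFinset.card * M) := by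
    refine (lintegral_iUnion_le _ _).trans ?_
    rw [tsum_fintype]
    refine (Finset.sum_le_sum fun (x : htf.toFinset) _ => h (x : ℂ) ?_).trans ?_
    · exact mem_sphere_zero_iff_norm.1 (hts (htf.mem_toFinset.1 x.2))
    · rw [Finset.sum_const, nsmul_eq_mul, ENNReal.ofReal_mul (by positivity),
        ENNReal.ofReal_natCast]
      simp
  calc ∫⁻ z, density p γ f z = ∫⁻ z in univ, density p γ f z := by rw [setLIntegral_univ]
    _ ≤ _ := lintegral_mono_set hcover
    _ ≤ _ := lintegral_union_le _ _ _
    _ ≤ ENNReal.ofReal (K * M * V) + ENNReal.ofReal (htf.toFinset.card * M) := add_le_add hin hout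
    _ = _ := by
        rw [← ENNReal.ofReal_add (by positivity) (by positivity)]
        congr 1; ring

/-- Functions in the analytic tent space satisfy a Carleson bound with a constant gauge. -/
theorem exists_carlesonBound_of_analyticTent {ζ p α : ℝ} (hζ : 1 / 2 < ζ) (hp : 0 < p)
    (hα : -2 < α) :
    ∃ C : ℝ, 0 < C ∧ ∀ f ∈ analyticTent ζ p α,
      CarlesonBound p (α + 1) f fun _ => C * (tentNorm ζ p α f).toReal ^ p := by
  have hpi := Real.pi_pos
  have hζ0 : 0 < ζ := by linarith
  have hρ : 1 / ζ - 1 < 1 := by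
    have : 1 / ζ < 2 := by rw [div_lt_iff₀ hζ0]; linarith
    linarith
  -- Chosen so that for `s ≤ s₀` the point `(1 - 8 * s) * η` has norm above `1 / ζ - 1` and its box
  -- average is controlled. Larger scales use the total mass, which scale `s₀` already bounds.
  set s₀ : ℝ := min (1 - (1 / ζ - 1)) 1 / 16 with hs₀
  have hmin : 0 < min (1 - (1 / ζ - 1)) 1 := lt_min (by linarith) one_pos
  have hs₀0 : 0 < s₀ := by positivity
  have hs₀1 : 16 * s₀ ≤ 1 := by
    have := min_le_right (1 - (1 / ζ - 1)) 1
    rw [hs₀]; linarith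
  have hs₀ζ : 16 * s₀ ≤ 1 - (1 / ζ - 1) := by
    have := min_le_left (1 - (1 / ζ - 1)) 1
    rw [hs₀]; linarith
  obtain ⟨C, hC, htot⟩ := exists_lintegral_density_le (γ := α + 1) hp (by linarith) hs₀0
    (by linarith)
  set D : ℝ := 2 ^ |α + 1| * Real.pi * 16 with hD
  have hD0 : 0 < D := by positivity
  refine ⟨D + C * D, by positivity, fun f hf η hη s hs => ?_⟩
  set N := (tentNorm ζ p α f).toReal ^ p with hN
  have hN0 : 0 ≤ N := by positivity
  have hNe : tentNorm ζ p α f ^ p = ENNReal.ofReal N := by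
    rw [hN, ← ENNReal.ofReal_rpow_of_nonneg ENNReal.toReal_nonneg hp.le,
      ENNReal.ofReal_toReal hf.2.ne]
  have hsmall : ∀ s, 0 < s → s ≤ s₀ → ∀ η : ℂ, ‖η‖ = 1 →
      ∫⁻ z in ball η s, density p (α + 1) f z ≤ ENNReal.ofReal (D * s * N) := by
    intro s hs hss η hη
    have hr : 0 < 1 - 8 * s := by linarith
    have hnu : ‖((1 - 8 * s : ℝ) : ℂ) * η‖ = 1 - 8 * s := by
      rw [norm_mul, Complex.norm_real, Real.norm_of_nonneg hr.le, hη, mul_one]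
    refine (lintegral_density_le_boxAverage hη hs (by linarith)).trans ?_
    rw [ENNReal.ofReal_mul (p := D * s) (by positivity), ← hNe]
    refine mul_le_mul' le_rfl (boxAverage_le_tentNorm_rpow hp hζ0 ?_ ?_)
    · rw [mem_disk, hnu]; linarith
    · rw [hnu]; linarith
  rcases le_or_gt s s₀ with hss | hss
  · refine (hsmall s hs hss η hη).trans (ENNReal.ofReal_le_ofReal ?_)
    have : 0 ≤ C * D * N * s := by positivity
    linarith
  · refine (setLIntegral_le_lintegral _ _).trans ((htot f hf.1 (D * s₀ * N) (by positivity)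
      (hsmall s₀ hs₀0 le_rfl)).trans (ENNReal.ofReal_le_ofReal ?_))
    have h1 : C * (D * s₀ * N) ≤ C * (D * s * N) := by gcongr
    have : 0 ≤ D * N * s := by positivity
    linarith

theorem tendsto_comap_norm_iff {F : ℂ → ℝ≥0∞} :
    Filter.Tendsto F (Filter.comap (fun u : ℂ => ‖u‖) (𝓝[<] (1 : ℝ))) (𝓝 0) ↔
      ∀ ε : ℝ, 0 < ε → ∃ δ : ℝ, 0 < δ ∧ ∀ u : ℂ, 1 - δ < ‖u‖ → ‖u‖ < 1 →
        F u ≤ ENNReal.ofReal ε := by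
  have hb : (𝓝[<] (1 : ℝ)).HasBasis (fun δ : ℝ => 0 < δ) fun δ => Ioo (1 - δ) 1 := by
    refine (nhdsLT_basis (1 : ℝ)).to_hasBasis (fun b hb => ⟨1 - b, by linarith, by simp⟩)
      fun δ hδ => ⟨1 - δ, by linarith, subset_rfl⟩
  rw [(hb.comap _).tendsto_iff ENNReal.nhds_zero_basis_Iic]
  constructor
  · intro h ε hε
    obtain ⟨δ, hδ, H⟩ := h (ENNReal.ofReal ε) (by simpa using hε)
    exact ⟨δ, hδ, fun u h1 h2 => H u ⟨h1, h2⟩⟩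
  · intro h ε hε
    obtain ⟨r, hr0, hrε⟩ := ENNReal.lt_iff_exists_real_btwn.1 hε
    obtain ⟨hr1, hr2⟩ := hrε
    obtain ⟨δ, hδ, H⟩ := h r (by simpa using hr1)
    exact ⟨δ, hδ, fun u hu => (H u hu.1 hu.2).trans hr2.le⟩

/-- Below some scale `s₁` the vanishing box averages give `ε`; above it, `B = M / s₁ ^ a` makes `B *
s ^ a` dominate the constant bound `M` of the big space. -/
theorem exists_carlesonBound_of_littleAnalyticTent {ζ p α a : ℝ} (hζ : 1 / 2 < ζ) (hp : 0 < p)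
    (hα : -2 < α) (ha : 0 ≤ a) {f : ℂ → ℂ} (hf : f ∈ littleAnalyticTent ζ p α) {ε : ℝ}
    (hε : 0 < ε) :
    ∃ B : ℝ, 0 ≤ B ∧ CarlesonBound p (α + 1) f fun s => ε + B * s ^ a := by
  have hpi := Real.pi_pos
  obtain ⟨C, hC, hcb⟩ := exists_carlesonBound_of_analyticTent hζ hp hα
  have hf1 := hcb f hf.1
  set M := C * (tentNorm ζ p α f).toReal ^ p with hM
  have hM0 : 0 ≤ M := by positivity
  set D : ℝ := 2 ^ |α + 1| * Real.pi * 16 with hD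
  have hD0 : 0 < D := by positivity
  obtain ⟨δ, hδ, hbox⟩ := tendsto_comap_norm_iff.1 hf.2 (ε / D) (by positivity)
  set s₁ : ℝ := min δ 1 / 16 with hs₁
  have hs₁0 : 0 < s₁ := by have := lt_min hδ one_pos; positivity
  have hs₁1 : 16 * s₁ ≤ 1 := by
    have := min_le_right δ 1
    rw [hs₁]; linarith
  have hs₁δ : 16 * s₁ ≤ δ := by
    have := min_le_left δ 1
    rw [hs₁]; linarith
  refine ⟨M / s₁ ^ a, by positivity, fun η hη s hs => ?_⟩
  rcases le_or_gt s s₁ with hss | hss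
  · have hr : 0 < 1 - 8 * s := by linarith
    have hnu : ‖((1 - 8 * s : ℝ) : ℂ) * η‖ = 1 - 8 * s := by
      rw [norm_mul, Complex.norm_real, Real.norm_of_nonneg hr.le, hη, mul_one]
    have h1 : ∫⁻ z in ball η s, density p (α + 1) f z ≤
        ENNReal.ofReal (D * s) * ENNReal.ofReal (ε / D) := by
      refine (lintegral_density_le_boxAverage hη hs (by linarith)).trans ?_
      gcongr
      exact hbox _ (by rw [hnu]; linarith) (by rw [hnu]; linarith)
    rw [← ENNReal.ofReal_mul (by positivity)] at h1
    refine h1.trans (ENNReal.ofReal_le_ofReal ?_)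
    have h2 : D * s * (ε / D) = ε * s := by field_simp
    have h3 : 0 ≤ M / s₁ ^ a * s ^ a * s := by positivity
    linarith
  · refine (hf1 η hη s hs).trans (ENNReal.ofReal_le_ofReal ?_)
    gcongr
    have h1 : s₁ ^ a ≤ s ^ a := Real.rpow_le_rpow hs₁0.le hss.le ha
    have h2 : 0 < s₁ ^ a := by positivity
    have h3 : M ≤ M / s₁ ^ a * s ^ a := by
      rw [div_mul_eq_mul_div, le_div_iff₀ h2]
      gcongr
    linarith

theorem tentNorm_le_of_carlesonBound {ζ p α M : ℝ} (hp : 0 < p) (hM : 0 ≤ M) {f : ℂ → ℂ}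
    (h : CarlesonBound p (α + 1) f fun _ => M) :
    tentNorm ζ p α f ≤ ENNReal.ofReal ((2 ^ (|α + 1| + 1) * M) ^ (1 / p)) := by
  rw [← ENNReal.ofReal_rpow_of_nonneg (by positivity) (by positivity)]
  exact tentNorm_le_of_boxAverage_le hp fun u hu =>
    boxAverage_le_of_carlesonBound (fun _ _ => hM) h hu

theorem mem_littleAnalyticTent_of_carlesonBound {ζ p α a M : ℝ} (hp : 0 < p) (ha : 0 < a)
    (hM : 0 ≤ M) {f : ℂ → ℂ} (hf : f ∈ analyticOnDisk)
    (h : CarlesonBound p (α + 1) f fun _ => M)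
    (h₀ : ∀ ε : ℝ, 0 < ε →
      ∃ B : ℝ, 0 ≤ B ∧ CarlesonBound p (α + 1) f fun s => ε + B * s ^ a) :
    f ∈ littleAnalyticTent ζ p α := by
  refine ⟨⟨hf, (tentNorm_le_of_carlesonBound hp hM h).trans_lt ENNReal.ofReal_lt_top⟩,
    tendsto_comap_norm_iff.2 fun ε hε => ?_⟩
  set K : ℝ := 2 ^ (|α + 1| + 1) with hK
  have hK0 : 0 < K := by positivity
  obtain ⟨B, hB, hcb⟩ := h₀ (ε / (2 * K)) (by positivity)
  set X : ℝ := ε / (2 * K * (B + 1)) with hX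
  have hX0 : 0 < X := by positivity
  refine ⟨X ^ (1 / a) / 2, by positivity, fun u hu1 hu2 => ?_⟩
  refine (boxAverage_le_of_carlesonBound (fun s hs => by positivity) hcb
    (mem_disk.2 hu2)).trans (ENNReal.ofReal_le_ofReal ?_)
  have h1 : (2 * (1 - ‖u‖)) ^ a ≤ X := by
    calc (2 * (1 - ‖u‖)) ^ a ≤ (X ^ (1 / a)) ^ a :=
          Real.rpow_le_rpow (by linarith) (by linarith) ha.le
      _ = X := by rw [one_div, Real.rpow_inv_rpow hX0.le ha.ne']
  calc K * (ε / (2 * K) + B * (2 * (1 - ‖u‖)) ^ a) ≤ K * (ε / (2 * K) + (B + 1) * X) := by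
        gcongr
        linarith
    _ = ε := by rw [hX]; field_simp; ring

/-! ### Iterated primitives and derivatives -/

/-- An analytic function on the disk has a primitive vanishing at `0`; the fundamental theorem along
the segment identifies it with the integral. -/
theorem hasDerivAt_integrationOp {h : ℂ → ℂ} (hh : h ∈ analyticOnDisk) {z : ℂ} (hz : z ∈ disk) :
    HasDerivAt (integrationOp h) (h z) z := by
  obtain ⟨G, hG0, hG⟩ := (DifferentiableOn.isExactOn_ball hh).with_val_at 0 0
  have heq : ∀ w ∈ disk, integrationOp h w = G w := by
    intro w hw
    have hmem : ∀ t ∈ uIcc (0 : ℝ) 1, (t : ℂ) * w ∈ disk := by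
      intro t ht
      rw [uIcc_of_le zero_le_one] at ht
      rw [mem_disk, norm_mul, Complex.norm_real, Real.norm_of_nonneg ht.1]
      have := mem_disk.1 hw
      have := mul_le_of_le_one_left (norm_nonneg w) ht.2
      linarith
    have hd : ∀ t ∈ uIcc (0 : ℝ) 1,
        HasDerivAt (fun t : ℝ => G ((t : ℂ) * w)) (h ((t : ℂ) * w) * w) t := by
      intro t ht
      have h1 : HasDerivAt (fun t : ℝ => (t : ℂ) * w) (1 * w) t :=
        (Complex.ofRealCLM.hasDerivAt (x := t)).mul_const w
      rw [one_mul] at h1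
      exact (hG _ (hmem t ht)).comp t h1
    have hcont : ContinuousOn (fun t : ℝ => h ((t : ℂ) * w) * w) (uIcc 0 1) :=
      ((DifferentiableOn.continuousOn hh).comp (by fun_prop) hmem).mul continuousOn_const
    rw [integrationOp, intervalIntegral.integral_eq_sub_of_hasDerivAt hd hcont.intervalIntegrable]
    simp [hG0]
  exact (hG z hz).congr_of_eventuallyEq
    (Filter.eventuallyEq_of_mem (isOpen_disk.mem_nhds hz) heq)

theorem integrationOp_mem {h : ℂ → ℂ} (hh : h ∈ analyticOnDisk) :
    integrationOp h ∈ analyticOnDisk := fun _ hz =>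
  (hasDerivAt_integrationOp hh hz).differentiableAt.differentiableWithinAt

theorem iterate_integrationOp_mem {h : ℂ → ℂ} (hh : h ∈ analyticOnDisk) (n : ℕ) :
    integrationOp^[n] h ∈ analyticOnDisk := by
  induction n with
  | zero => exact hh
  | succ n ih => rw [Function.iterate_succ_apply']; exact integrationOp_mem ih

theorem iteratedDeriv_iterate_integrationOp {h : ℂ → ℂ} (hh : h ∈ analyticOnDisk) (n : ℕ) :
    EqOn (iteratedDeriv n (integrationOp^[n] h)) h disk := by
  induction n with
  | zero => intro z _; simp
  | succ n ih =>
    intro z hz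
    rw [iteratedDeriv_succ', Function.iterate_succ_apply']
    have : EqOn (deriv (integrationOp (integrationOp^[n] h))) (integrationOp^[n] h) disk :=
      fun w hw => (hasDerivAt_integrationOp (iterate_integrationOp_mem hh n) hw).deriv
    rw [this.iteratedDeriv_of_isOpen isOpen_disk n hz]
    exact ih hz

theorem iteratedDeriv_mem {f : ℂ → ℂ} (hf : f ∈ analyticOnDisk) (k : ℕ) :
    iteratedDeriv k f ∈ analyticOnDisk := by
  induction k with
  | zero => rwa [iteratedDeriv_zero]
  | succ k ih => rw [iteratedDeriv_succ]; exact DifferentiableOn.deriv ih isOpen_disk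

theorem CarlesonBound.mono {p γ : ℝ} {f : ℂ → ℂ} {ω ω' : ℝ → ℝ} (h : CarlesonBound p γ f ω)
    (hω : ∀ s, 0 < s → ω s ≤ ω' s) : CarlesonBound p γ f ω' := fun η hη s hs =>
  (h η hη s hs).trans (ENNReal.ofReal_le_ofReal (mul_le_mul_of_nonneg_right (hω s hs) hs.le))

theorem exists_carlesonBound_iteratedDeriv {p : ℝ} (hp : 0 < p) (γ a : ℝ) (k : ℕ) :
    ∃ C : ℝ, 0 < C ∧ ∀ f ∈ analyticOnDisk, ∀ ω, IsGauge a ω → CarlesonBound p γ f ω →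
      CarlesonBound p (γ + k * p) (iteratedDeriv k f) fun s => C * ω s := by
  induction k with
  | zero =>
    refine ⟨1, one_pos, fun f _ ω _ h => ?_⟩
    simpa using h
  | succ k ih =>
    obtain ⟨C₁, hC₁, h₁⟩ := ih
    obtain ⟨C₂, hC₂, h₂⟩ := exists_carlesonBound_deriv hp (γ + k * p) a
    refine ⟨C₂ * C₁, by positivity, fun f hf ω hω h => ?_⟩
    have := h₂ _ (iteratedDeriv_mem hf k) _ (hω.const_mul hC₁.le) (h₁ f hf ω hω h)
    rw [iteratedDeriv_succ]
    simp only [mul_assoc]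
    convert this using 1
    push_cast; ring

theorem exists_carlesonBound_iterate_integrationOp {q : ℝ} (hq : 0 < q) {γ a : ℝ} (ha : 0 < a)
    (haγ : a < γ + 1) (n : ℕ) :
    ∃ C : ℝ, 0 < C ∧ ∀ h ∈ analyticOnDisk, ∀ ω, IsGauge a ω → CarlesonBound q (γ + n * q) h ω →
      CarlesonBound q γ (integrationOp^[n] h) fun s => C * ω s := by
  induction n with
  | zero =>
    refine ⟨1, one_pos, fun f _ ω _ h => ?_⟩
    simpa using h
  | succ n ih =>
    obtain ⟨C₁, hC₁, h₁⟩ := ih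
    have hnq : 0 ≤ n * q := by positivity
    -- Intermediate weights have exponent at least `γ`, so the same gauge exponent `a` is admissible
    -- at every stage.
    obtain ⟨C₂, hC₂, h₂⟩ := exists_carlesonBound_integrationOp hq (γ := γ + n * q) ha (by linarith)
    refine ⟨C₁ * C₂, by positivity, fun h hh ω hω hcb => ?_⟩
    have h3 : CarlesonBound q (γ + n * q + q) h ω := by
      convert hcb using 1
      push_cast; ring
    have := h₁ _ (integrationOp_mem hh) _ (hω.const_mul hC₂.le) (h₂ h hh ω hω h3)
    rw [Function.iterate_succ_apply]
    simpa only [mul_assoc] using this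

/-! ### Sufficiency -/

/-- One factor `x ^ p` of `x ^ q` is kept to be integrated; the remaining `x ^ (q - p)` is absorbed
by the growth bound, and this is where `p ≤ q` enters. -/
theorem mul_rpow_mul_rpow_le {p q e κ τ σ x y d W G : ℝ} (hp : 0 < p) (hpq : p ≤ q) (hx : 0 ≤ x)
    (hy : 0 ≤ y) (hd : 0 < d) (hW : 0 ≤ W) (hyW : y ≤ W * d ^ (-e)) (hxG : x ^ p * d ^ κ ≤ G)
    (hexp : τ - q * e - κ * ((q - p) / p) = σ) :
    (x * y) ^ q * d ^ τ ≤ W ^ q * G ^ ((q - p) / p) * (x ^ p * d ^ σ) := by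
  have hq : 0 < q := hp.trans_le hpq
  have hr : 0 ≤ (q - p) / p := div_nonneg (by linarith) hp.le
  have hG : 0 ≤ G := le_trans (by positivity) hxG
  have h1 : y ^ q ≤ W ^ q * d ^ (-(q * e)) := by
    have := Real.rpow_le_rpow hy hyW hq.le
    rwa [Real.mul_rpow hW (by positivity), ← Real.rpow_mul hd.le,
      show -e * q = -(q * e) by ring] at this
  have h2 : x ^ (q - p) ≤ G ^ ((q - p) / p) * d ^ (-(κ * ((q - p) / p))) := by
    have h3 : x ^ p ≤ G * d ^ (-κ) := by
      rw [Real.rpow_neg hd.le, ← div_eq_mul_inv, le_div_iff₀ (by positivity)]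
      exact hxG
    have := Real.rpow_le_rpow (by positivity) h3 hr
    rwa [Real.mul_rpow hG (by positivity), ← Real.rpow_mul hd.le, ← Real.rpow_mul hx,
      mul_div_cancel₀ _ hp.ne', neg_mul] at this
  have h4 : x ^ q = x ^ p * x ^ (q - p) := by
    rw [← Real.rpow_add_of_nonneg hx hp.le (by linarith)]; congr 1; ring
  calc (x * y) ^ q * d ^ τ = x ^ p * x ^ (q - p) * y ^ q * d ^ τ := by
        rw [Real.mul_rpow hx hy, h4]
    _ ≤ x ^ p * (G ^ ((q - p) / p) * d ^ (-(κ * ((q - p) / p)))) * (W ^ q * d ^ (-(q * e))) *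
          d ^ τ := by gcongr
    _ = W ^ q * G ^ ((q - p) / p) * (x ^ p *
          (d ^ (-(κ * ((q - p) / p))) * d ^ (-(q * e)) * d ^ τ)) := by ring
    _ = _ := by
        rw [← Real.rpow_add hd, ← Real.rpow_add hd, ← hexp]
        congr 3; ring

theorem genIntegrand_mem {f g : ℂ → ℂ} (hf : f ∈ analyticOnDisk) (hg : g ∈ analyticOnDisk)
    (k m : ℕ) : (fun z => iteratedDeriv k f z * iteratedDeriv m g z) ∈ analyticOnDisk :=
  DifferentiableOn.mul (iteratedDeriv_mem hf k) (iteratedDeriv_mem hg m)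

/-- If the weighted supremum of `g` is at most `U`, the operator `T_g^{n,k}` carries Carleson bounds
to Carleson bounds, preserving the gauge. -/
theorem exists_carlesonBound_genIntegrationOp {p q α β a : ℝ} (hp : 0 < p) (hpq : p ≤ q)
    (ha : 0 < a) (haβ : a < β + 2) {g : ℂ → ℂ} (hg : g ∈ analyticOnDisk) (n k : ℕ)
    {U : ℝ} (hU : 0 ≤ U) (hgU : ∀ z ∈ disk, ‖iteratedDeriv (n - k) g z‖ *
      (1 - ‖z‖ ^ 2) ^ ((n : ℝ) - k + (β + 2) / q - (α + 2) / p) ≤ U) :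
    ∃ K : ℝ, 0 ≤ K ∧ ∀ f ∈ analyticOnDisk, ∀ M : ℝ, 0 ≤ M →
      CarlesonBound p (α + 1) f (fun _ => M) → ∀ ω, IsGauge a ω → CarlesonBound p (α + 1) f ω →
        CarlesonBound q (β + 1) (genIntegrationOp g n k f)
          fun s => K * M ^ ((q - p) / p) * ω s := by
  have hq : 0 < q := hp.trans_le hpq
  set e : ℝ := (n : ℝ) - k + (β + 2) / q - (α + 2) / p with he
  obtain ⟨C₁, hC₁, hder⟩ := exists_carlesonBound_iteratedDeriv hp (α + 1) a k
  obtain ⟨C₂, hC₂, hgrow⟩ := exists_growth_of_carlesonBound hp (α + 1 + k * p) a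
  obtain ⟨C₃, hC₃, hint⟩ := exists_carlesonBound_iterate_integrationOp hq (γ := β + 1) ha
    (by linarith) n
  set W : ℝ := U * 2 ^ |e| with hW
  have hW0 : 0 ≤ W := by positivity
  refine ⟨C₃ * (W ^ q * (C₂ * C₁) ^ ((q - p) / p)) * C₁, by positivity,
    fun f hf M hM hfM ω hω hfω => ?_⟩
  -- The `q - p` power uses the constant gauge `M`, so `ω` enters only linearly and remains a gauge
  -- of exponent `a`.
  have hMg : IsGauge a fun _ => M := isGauge_const ha.le hM
  set φ := iteratedDeriv k f with hφ
  set G : ℝ := C₂ * (C₁ * M) with hG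
  have hG0 : 0 ≤ G := by positivity
  have hφG : ∀ z ∈ disk, ‖φ z‖ ^ p * (1 - ‖z‖) ^ (α + 1 + k * p + 1) ≤ G := fun z hz =>
    hgrow φ (iteratedDeriv_mem hf k) _ (hMg.const_mul hC₁.le) (hder f hf _ hMg hfM) z hz
  have hpt : ∀ z ∈ disk,
      ‖φ z * iteratedDeriv (n - k) g z‖ ^ q * (1 - ‖z‖) ^ (β + 1 + n * q) ≤
        W ^ q * G ^ ((q - p) / p) * (‖φ z‖ ^ p * (1 - ‖z‖) ^ (α + 1 + k * p)) := by
    intro z hz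
    have hz1 := mem_disk.1 hz
    have hn := norm_nonneg z
    have hd : 0 < 1 - ‖z‖ := by linarith
    have hd2 : 0 < 1 - ‖z‖ ^ 2 := by nlinarith
    rw [norm_mul]
    refine mul_rpow_mul_rpow_le (e := e) hp hpq (norm_nonneg _) (norm_nonneg _) hd hW0 ?_
      (hφG z hz) ?_
    · have h1 := hgU z hz
      have h2 := (one_sub_sq_rpow_le hz e).2
      rw [Real.rpow_neg hd.le, ← div_eq_mul_inv, le_div_iff₀ (by positivity), hW]
      calc _ ≤ ‖iteratedDeriv (n - k) g z‖ * (2 ^ |e| * (1 - ‖z‖ ^ 2) ^ e) := by gcongr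
        _ = 2 ^ |e| * (‖iteratedDeriv (n - k) g z‖ * (1 - ‖z‖ ^ 2) ^ e) := by ring
        _ ≤ 2 ^ |e| * U := by gcongr
        _ = _ := mul_comm _ _
    · rw [he]; field_simp; ring
  have hh : CarlesonBound q (β + 1 + n * q) (fun z => φ z * iteratedDeriv (n - k) g z)
      fun s => W ^ q * G ^ ((q - p) / p) * (C₁ * ω s) := by
    intro η hη s hs
    calc _ ≤ ∫⁻ z in ball η s, ENNReal.ofReal (W ^ q * G ^ ((q - p) / p)) *
          density p (α + 1 + k * p) φ z := by
          refine lintegral_mono fun z => ?_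
          by_cases hz : z ∈ disk
          · rw [density, density, indicator_of_mem hz, indicator_of_mem hz,
              ← ENNReal.ofReal_mul (by positivity)]
            exact ENNReal.ofReal_le_ofReal (hpt z hz)
          · simp [density, hz]
      _ ≤ ENNReal.ofReal (W ^ q * G ^ ((q - p) / p)) * ENNReal.ofReal (C₁ * ω s * s) := by
          rw [lintegral_const_mul' _ _ ENNReal.ofReal_ne_top]
          gcongr
          exact hder f hf ω hω hfω η hη s hs
      _ = _ := by
          rw [← ENNReal.ofReal_mul (by positivity)]
          congr 1; ring
  have hfin := hint _ (genIntegrand_mem hf hg k (n - k)) _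
    ((hω.const_mul hC₁.le).const_mul (C := W ^ q * G ^ ((q - p) / p)) (by positivity)) hh
  refine hfin.mono fun s hs => le_of_eq ?_
  have hGs : G ^ ((q - p) / p) = (C₂ * C₁) ^ ((q - p) / p) * M ^ ((q - p) / p) := by
    rw [hG, ← mul_assoc, Real.mul_rpow (by positivity) hM]
  rw [hGs]; ring

theorem boundedLittleTent_of_weightedSup_lt_top {ζ p q α β : ℝ} (hζ : 1 / 2 < ζ) (hp : 0 < p)
    (hpq : p ≤ q) (hα : -2 < α) (hβ : -2 < β) {g : ℂ → ℂ} (hg : g ∈ analyticOnDisk) {n k : ℕ}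
    (hU : weightedSup p q α β n k g < ⊤) :
    BoundedLittleTent ζ p α q β (genIntegrationOp g n k) := by
  have hq : 0 < q := hp.trans_le hpq
  set U := (weightedSup p q α β n k g).toReal
  have hgU : ∀ z ∈ disk, ‖iteratedDeriv (n - k) g z‖ *
      (1 - ‖z‖ ^ 2) ^ ((n : ℝ) - k + (β + 2) / q - (α + 2) / p) ≤ U := by
    intro z hz
    rw [← ENNReal.ofReal_le_ofReal_iff ENNReal.toReal_nonneg, ENNReal.ofReal_toReal hU.ne]
    exact le_iSup₂ (f := fun z (_ : z ∈ disk) => ENNReal.ofReal (‖iteratedDeriv (n - k) g z‖ *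
      (1 - ‖z‖ ^ 2) ^ ((n : ℝ) - k + (β + 2) / q - (α + 2) / p))) z hz
  -- Any exponent strictly between `0` and `β + 2` would serve.
  set a : ℝ := (β + 2) / 2 with ha
  have ha0 : 0 < a := by rw [ha]; linarith
  obtain ⟨K, hK, hT⟩ := exists_carlesonBound_genIntegrationOp hp hpq ha0
    (by rw [ha]; linarith) hg n k ENNReal.toReal_nonneg hgU
  obtain ⟨C, hC, hcb⟩ := exists_carlesonBound_of_analyticTent hζ hp hα
  set L : ℝ := 2 ^ (|β + 1| + 1) * (K * C ^ (q / p)) with hL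
  have hL0 : 0 ≤ L := by positivity
  refine ⟨(L ^ (1 / q)).toNNReal, fun f hf => ?_⟩
  set N := (tentNorm ζ p α f).toReal with hN
  have hN0 : 0 ≤ N := ENNReal.toReal_nonneg
  have hfM := hcb f hf.1
  set M := C * N ^ p with hM
  have hM0 : 0 ≤ M := by positivity
  have hTM := hT f hf.1.1 M hM0 hfM _ (isGauge_const ha0.le hM0) hfM
  have hTmem : genIntegrationOp g n k f ∈ analyticOnDisk :=
    iterate_integrationOp_mem (genIntegrand_mem hf.1.1 hg k (n - k)) n
  set c := K * M ^ ((q - p) / p) with hc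
  have hc0 : 0 ≤ c := by positivity
  refine ⟨mem_littleAnalyticTent_of_carlesonBound hq ha0 (by positivity) hTmem hTM
    fun ε hε => ?_, ?_⟩
  · obtain ⟨B, hB, hfB⟩ := exists_carlesonBound_of_littleAnalyticTent hζ hp hα ha0.le hf
      (ε := ε / (c + 1)) (by positivity)
    refine ⟨c * B, by positivity, (hT f hf.1.1 M hM0 hfM _
      (isGauge_add_mul_rpow ha0.le (by positivity) hB) hfB).mono fun s hs => ?_⟩
    have h1 : c * (ε / (c + 1)) ≤ ε := by
      rw [← mul_div_assoc, div_le_iff₀ (by positivity)]; nlinarith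
    calc c * (ε / (c + 1) + B * s ^ a) = c * (ε / (c + 1)) + c * B * s ^ a := by ring
      _ ≤ _ := by gcongr
  · refine (tentNorm_le_of_carlesonBound hq (by positivity) hTM).trans (le_of_eq ?_)
    have h1 : c * M = K * C ^ (q / p) * N ^ q := by
      -- With `M = C * N ^ p` this is a multiple of `N ^ q`, so the `q`-th root is linear in the
      -- quasi-norm.
      have h2 : M ^ ((q - p) / p) * M = M ^ (q / p) := by
        have h3 : (q - p) / p + 1 = q / p := by field_simp; ring
        have h4 := Real.rpow_add_of_nonneg hM0 (y := (q - p) / p) (z := 1)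
          (div_nonneg (by linarith) hp.le) zero_le_one
        rw [h3, Real.rpow_one] at h4
        exact h4.symm
      rw [hc, mul_assoc, h2, hM, Real.mul_rpow hC.le (by positivity), ← Real.rpow_mul hN0,
        mul_div_cancel₀ _ hp.ne', mul_assoc]
    rw [h1, ← mul_assoc, ← hL, Real.mul_rpow hL0 (by positivity), one_div,
      Real.rpow_rpow_inv hN0 hq.ne', ENNReal.ofReal_mul (by positivity), hN,
      ENNReal.ofReal_toReal hf.1.2.ne]
    rfl

/-! ### Test kernels -/

/-- The normalized kernel `(1 - ‖a‖) ^ (N - κ) / (1 - conj a * z) ^ N`. -/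
noncomputable def kernelFunction (κ : ℝ) (N : ℕ) (a z : ℂ) : ℂ :=
  (((1 - ‖a‖) ^ ((N : ℝ) - κ) : ℝ) : ℂ) * ((1 - conj a * z) ^ N)⁻¹

theorem one_sub_norm_le_norm_one_sub_conj_mul (a : ℂ) {z : ℂ} (hz : z ∈ disk) :
    1 - ‖a‖ ≤ ‖1 - conj a * z‖ := by
  have h1 := norm_sub_norm_le (1 : ℂ) (conj a * z)
  rw [norm_one, norm_mul, RCLike.norm_conj] at h1
  have := mem_disk.1 hz
  have := mul_le_of_le_one_right (norm_nonneg a) this.le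
  linarith

theorem one_sub_conj_mul_ne_zero {a z : ℂ} (ha : a ∈ disk) (hz : z ∈ disk) :
    1 - conj a * z ≠ 0 := by
  rw [← norm_pos_iff]
  have := mem_disk.1 ha
  linarith [one_sub_norm_le_norm_one_sub_conj_mul a hz]

theorem norm_sub_le_two_mul_norm_one_sub_conj_mul {a z η : ℂ} (hη : ‖η‖ = 1)
    (haη : ‖a - η‖ = 1 - ‖a‖) (hz : z ∈ disk) : ‖z - η‖ ≤ 2 * ‖1 - conj a * z‖ := by
  have hηη : conj η * η = 1 := by
    rw [mul_comm, Complex.mul_conj, Complex.normSq_eq_norm_sq, hη]; simp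
  have h1 : ‖z - η‖ = ‖conj η * z - 1‖ := by
    have : conj η * z - 1 = conj η * (z - η) := by rw [mul_sub, hηη]
    rw [this, norm_mul, RCLike.norm_conj, hη, one_mul]
  have h2 : conj η * z - 1 = -(1 - conj a * z) - conj (a - η) * z := by
    rw [map_sub]; ring
  rw [h1, h2]
  refine (norm_sub_le _ _).trans ?_
  rw [norm_neg, norm_mul, RCLike.norm_conj, haη]
  have h3 := one_sub_norm_le_norm_one_sub_conj_mul a hz
  have h4 := mem_disk.1 hz
  have h5 : (1 - ‖a‖) * ‖z‖ ≤ ‖1 - conj a * z‖ * 1 :=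
    mul_le_mul h3 h4.le (norm_nonneg z) (norm_nonneg _)
  linarith

theorem iteratedDeriv_kernelFunction (κ : ℝ) (N : ℕ) {a : ℂ} (ha : a ∈ disk) (k : ℕ) :
    EqOn (iteratedDeriv k (kernelFunction κ N a)) (fun z =>
      (((1 - ‖a‖) ^ ((N : ℝ) - κ) : ℝ) : ℂ) *
        (N.ascFactorial k * conj a ^ k * ((1 - conj a * z) ^ (N + k))⁻¹)) disk := by
  induction k with
  | zero => intro z _; simp [kernelFunction]
  | succ k ih =>
    intro z hz
    rw [iteratedDeriv_succ]
    have hev := Filter.eventuallyEq_of_mem (isOpen_disk.mem_nhds hz) ih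
    rw [hev.deriv_eq]
    have hne := one_sub_conj_mul_ne_zero ha hz
    have h1 : HasDerivAt (fun z => 1 - conj a * z) (-conj a) z := by
      simpa using ((hasDerivAt_id z).const_mul (conj a)).const_sub 1
    have h2 := (((h1.pow (N + k)).inv (pow_ne_zero _ hne)).const_mul
      ((N.ascFactorial k : ℂ) * conj a ^ k)).const_mul (((1 - ‖a‖) ^ ((N : ℝ) - κ) : ℝ) : ℂ)
    refine h2.deriv.trans ?_
    congr 1
    rw [Nat.ascFactorial_succ]
    -- Separated because differentiating the power produces the natural-number exponent `N + k - 1`.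
    rcases Nat.eq_zero_or_pos (N + k) with h0 | h0
    · simp [h0]
    · obtain ⟨m, hm⟩ := Nat.exists_eq_add_of_lt h0
      rw [zero_add] at hm
      rw [← add_assoc, hm]
      simp only [Pi.pow_apply, Nat.add_sub_cancel]
      push_cast
      field_simp
      ring

theorem kernelFunction_mem (κ : ℝ) (N : ℕ) {a : ℂ} (ha : a ∈ disk) :
    kernelFunction κ N a ∈ analyticOnDisk := by
  intro z hz
  have h : DifferentiableAt ℂ (fun z => (1 - conj a * z) ^ N) z := by fun_prop
  exact ((h.fun_inv (pow_ne_zero _ (one_sub_conj_mul_ne_zero ha hz))).const_mul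
    _).differentiableWithinAt

theorem norm_kernelFunction (κ : ℝ) (N : ℕ) {a : ℂ} (ha : a ∈ disk) (z : ℂ) :
    ‖kernelFunction κ N a z‖ = (1 - ‖a‖) ^ ((N : ℝ) - κ) * (‖1 - conj a * z‖ ^ N)⁻¹ := by
  have := mem_disk.1 ha
  rw [kernelFunction, norm_mul, norm_inv, norm_pow, Complex.norm_real, Real.norm_of_nonneg]
  exact Real.rpow_nonneg (by linarith) _

theorem rpow_norm_kernelFunction {p γ : ℝ} (hp : 0 < p) (N : ℕ) {a z : ℂ} (ha : a ∈ disk) :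
    ‖kernelFunction ((γ + 1) / p) N a z‖ ^ p =
      (1 - ‖a‖) ^ (N * p - (γ + 1)) * ‖1 - conj a * z‖ ^ (-(N * p)) := by
  have hd : 0 < 1 - ‖a‖ := by have := mem_disk.1 ha; linarith
  rw [norm_kernelFunction _ _ ha, Real.mul_rpow (by positivity) (by positivity),
    ← Real.rpow_mul hd.le, Real.inv_rpow (by positivity), ← Real.rpow_natCast,
    ← Real.rpow_mul (norm_nonneg _), ← Real.rpow_neg (norm_nonneg _)]
  congr 2
  field_simp

theorem rpow_norm_kernelFunction_le {p γ : ℝ} (hp : 0 < p) (N : ℕ) {a z : ℂ} (ha : a ∈ disk)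
    (hz : z ∈ disk) : ‖kernelFunction ((γ + 1) / p) N a z‖ ^ p ≤ (1 - ‖a‖) ^ (-(γ + 1)) := by
  have hd : 0 < 1 - ‖a‖ := by have := mem_disk.1 ha; linarith
  rw [rpow_norm_kernelFunction hp N ha]
  have h1 : ‖1 - conj a * z‖ ^ (-(N * p)) ≤ (1 - ‖a‖) ^ (-(N * p)) :=
    Real.rpow_le_rpow_of_nonpos hd (one_sub_norm_le_norm_one_sub_conj_mul a hz)
      (neg_nonpos.2 (by positivity))
  calc _ ≤ (1 - ‖a‖) ^ (N * p - (γ + 1)) * (1 - ‖a‖) ^ (-(N * p)) := by gcongr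
    _ = _ := by rw [← Real.rpow_add hd]; congr 1; ring

theorem lintegral_density_kernelFunction_ball_le {p γ : ℝ} (hp : 0 < p) (hγ : -1 < γ) (N : ℕ)
    {a : ℂ} (ha : a ∈ disk) {η : ℂ} (hη : ‖η‖ = 1) {s : ℝ} (hs : 0 < s) :
    ∫⁻ z in ball η s, density p γ (kernelFunction ((γ + 1) / p) N a) z ≤
      ENNReal.ofReal ((1 - ‖a‖) ^ (-(γ + 1)) * (2 * Real.pi / (γ + 1) * s ^ (γ + 2))) := by
  have hd : 0 < 1 - ‖a‖ := by have := mem_disk.1 ha; linarith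
  have hms : MeasurableSet (disk ∩ ball η s) := isOpen_disk.measurableSet.inter measurableSet_ball
  rw [setLIntegral_density, ENNReal.ofReal_mul (by positivity)]
  calc _ ≤ ∫⁻ z in disk ∩ ball η s, ENNReal.ofReal ((1 - ‖a‖) ^ (-(γ + 1))) *
        ENNReal.ofReal ((1 - ‖z‖) ^ γ) := by
        refine setLIntegral_mono' hms fun z hz => ?_
        have hz1 := mem_disk.1 hz.1
        rw [← ENNReal.ofReal_mul (by positivity)]
        apply ENNReal.ofReal_le_ofReal
        have : 0 ≤ (1 - ‖z‖) ^ γ := Real.rpow_nonneg (by linarith) _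
        gcongr
        exact rpow_norm_kernelFunction_le hp N ha hz.1
    _ ≤ _ := by
        rw [lintegral_const_mul' _ _ ENNReal.ofReal_ne_top]
        exact mul_le_mul' le_rfl (lintegral_disk_inter_ball_rpow_le hγ hs hη)

/-- Dyadic decomposition by the size of `‖1 - conj a * z‖ / (1 - ‖a‖)`. The `j`-th shell lies in a
boundary ball of radius `4 * 2 ^ j * (1 - ‖a‖)`, and `γ + 3 ≤ N * p` makes its contribution decay
like `2 ^ (-j)`. -/
theorem lintegral_density_kernelFunction_le {p γ : ℝ} (hp : 0 < p) (hγ : -1 < γ) {N : ℕ}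
    (hN : γ + 3 ≤ N * p) {a : ℂ} (ha : a ∈ disk) :
    ∫⁻ z, density p γ (kernelFunction ((γ + 1) / p) N a) z ≤
      ENNReal.ofReal (2 * Real.pi / (γ + 1) * 4 ^ (γ + 2) * 2 * (1 - ‖a‖)) := by
  have hpi := Real.pi_pos
  have hd : 0 < 1 - ‖a‖ := by have := mem_disk.1 ha; linarith
  have hγ1 : 0 < γ + 1 := by linarith
  obtain ⟨η, hη, haη⟩ := exists_norm_eq_one_norm_sub_eq a ha
  set δ := 1 - ‖a‖ with hδ
  set m : ℝ := N * p with hm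
  have hm0 : 0 < m := by linarith
  set V : ℝ := 2 * Real.pi / (γ + 1) with hV
  have hV0 : 0 < V := by positivity
  set c : ℕ → ℝ := fun j => δ ^ (m - (γ + 1)) * (2 ^ j * δ) ^ (-m) with hc
  have hc0 : ∀ j, 0 ≤ c j := fun j => by positivity
  set A : ℕ → Set ℂ := fun j => disk ∩ ball η (4 * (2 ^ j * δ)) with hA
  have hAm : ∀ j, MeasurableSet (A j) := fun j =>
    isOpen_disk.measurableSet.inter measurableSet_ball
  have hpt : ∀ z, density p γ (kernelFunction ((γ + 1) / p) N a) z ≤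
      ∑' j, (A j).indicator (fun z => ENNReal.ofReal (c j) * ENNReal.ofReal ((1 - ‖z‖) ^ γ)) z := by
    intro z
    by_cases hz : z ∈ disk
    swap
    · simp [density, hz]
    have hz1 := mem_disk.1 hz
    have hX := one_sub_norm_le_norm_one_sub_conj_mul a hz
    rw [← hδ] at hX
    obtain ⟨j, hj1, hj2⟩ := exists_nat_pow_near ((one_le_div hd).2 hX) (one_lt_two)
    rw [le_div_iff₀ hd] at hj1
    rw [div_lt_iff₀ hd, pow_succ] at hj2
    have hzA : z ∈ A j := by
      refine ⟨hz, ?_⟩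
      rw [mem_ball, dist_eq_norm]
      have := norm_sub_le_two_mul_norm_one_sub_conj_mul hη haη hz
      linarith
    refine le_trans ?_ (ENNReal.le_tsum j)
    rw [indicator_of_mem hzA, density, indicator_of_mem hz, ← ENNReal.ofReal_mul (hc0 j)]
    apply ENNReal.ofReal_le_ofReal
    have h0 : 0 ≤ (1 - ‖z‖) ^ γ := Real.rpow_nonneg (by linarith) _
    rw [rpow_norm_kernelFunction hp N ha]
    have h1 : ‖1 - conj a * z‖ ^ (-m) ≤ (2 ^ j * δ) ^ (-m) :=
      Real.rpow_le_rpow_of_nonpos (by positivity) hj1 (by linarith)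
    simp only [hc]
    gcongr
  have hterm : ∀ j, ∫⁻ z, (A j).indicator
      (fun z => ENNReal.ofReal (c j) * ENNReal.ofReal ((1 - ‖z‖) ^ γ)) z ≤
        ENNReal.ofReal (V * 4 ^ (γ + 2) * δ * (1 / 2) ^ j) := by
    intro j
    have h2 : (0 : ℝ) < 2 ^ j * δ := by positivity
    rw [lintegral_indicator (hAm j), lintegral_const_mul' _ _ ENNReal.ofReal_ne_top]
    refine (mul_le_mul' le_rfl (lintegral_disk_inter_ball_rpow_le hγ
      (by positivity : 0 < 4 * (2 ^ j * δ)) hη)).trans ?_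
    rw [← ENNReal.ofReal_mul (hc0 j)]
    apply ENNReal.ofReal_le_ofReal
    have h3 : δ ^ (m - (γ + 1)) * δ ^ (-m) * δ ^ (γ + 2) = δ := by
      rw [← Real.rpow_add hd, ← Real.rpow_add hd,
        show m - (γ + 1) + -m + (γ + 2) = 1 by ring, Real.rpow_one]
    have h4 : ((2 : ℝ) ^ j) ^ (-m) * ((2 : ℝ) ^ j) ^ (γ + 2) ≤ (1 / 2) ^ j := by
      rw [← Real.rpow_add (by positivity)]
      calc ((2 : ℝ) ^ j) ^ (-m + (γ + 2)) ≤ ((2 : ℝ) ^ j) ^ (-1 : ℝ) :=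
            Real.rpow_le_rpow_of_exponent_le (one_le_pow₀ one_le_two) (by linarith)
        _ = (1 / 2) ^ j := by rw [Real.rpow_neg_one, one_div, inv_pow]
    calc c j * (V * (4 * (2 ^ j * δ)) ^ (γ + 2))
        = V * 4 ^ (γ + 2) * (δ ^ (m - (γ + 1)) * δ ^ (-m) * δ ^ (γ + 2)) *
          (((2 : ℝ) ^ j) ^ (-m) * ((2 : ℝ) ^ j) ^ (γ + 2)) := by
          simp only [hc]
          rw [Real.mul_rpow (by norm_num) h2.le, Real.mul_rpow (by positivity) hd.le,
            Real.mul_rpow (by positivity) hd.le]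
          ring
      _ ≤ _ := by
          rw [h3]
          gcongr
  calc _ ≤ ∫⁻ z, ∑' j, (A j).indicator
        (fun z => ENNReal.ofReal (c j) * ENNReal.ofReal ((1 - ‖z‖) ^ γ)) z := lintegral_mono hpt
    _ = ∑' j, ∫⁻ z, (A j).indicator
        (fun z => ENNReal.ofReal (c j) * ENNReal.ofReal ((1 - ‖z‖) ^ γ)) z :=
        lintegral_tsum fun j => (Measurable.indicator (by fun_prop) (hAm j)).aemeasurable
    _ ≤ ∑' j : ℕ, ENNReal.ofReal (V * 4 ^ (γ + 2) * δ * (1 / 2) ^ j) :=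
        ENNReal.tsum_le_tsum hterm
    _ = _ := by
        rw [← ENNReal.ofReal_tsum_of_nonneg (fun j => by positivity)
          (summable_geometric_two.mul_left _), tsum_mul_left, tsum_geometric_two]
        congr 1; ring

/-- Up to scale `1 - ‖a‖` the supremum of the kernel suffices; beyond it, the total mass is of order
`1 - ‖a‖ < s`. The constant does not depend on `a`. -/
theorem exists_carlesonBound_kernelFunction {p γ : ℝ} (hp : 0 < p) (hγ : -1 < γ) {N : ℕ}
    (hN : γ + 3 ≤ N * p) :
    ∃ M : ℝ, 0 < M ∧ ∀ a ∈ disk,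
      CarlesonBound p γ (kernelFunction ((γ + 1) / p) N a) fun _ => M := by
  have hpi := Real.pi_pos
  have hγ1 : 0 < γ + 1 := by linarith
  set V : ℝ := 2 * Real.pi / (γ + 1) with hV
  have hV0 : 0 < V := by positivity
  refine ⟨V + V * 4 ^ (γ + 2) * 2, by positivity, fun a ha η hη s hs => ?_⟩
  have hd : 0 < 1 - ‖a‖ := by have := mem_disk.1 ha; linarith
  rcases le_or_gt s (1 - ‖a‖) with hsd | hsd
  · refine (lintegral_density_kernelFunction_ball_le hp hγ N ha hη hs).trans
      (ENNReal.ofReal_le_ofReal ?_)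
    have h1 : (1 - ‖a‖) ^ (-(γ + 1)) * s ^ (γ + 1) ≤ 1 := by
      rw [Real.rpow_neg hd.le, inv_mul_le_iff₀ (by positivity), mul_one]
      exact Real.rpow_le_rpow hs.le hsd hγ1.le
    have h2 : s ^ (γ + 2) = s ^ (γ + 1) * s := by
      rw [← Real.rpow_add_one hs.ne']; congr 1; ring
    have h3 : 0 ≤ V * 4 ^ (γ + 2) * 2 * s := by positivity
    calc _ = (1 - ‖a‖) ^ (-(γ + 1)) * s ^ (γ + 1) * (V * s) := by rw [h2, hV]; ring
      _ ≤ 1 * (V * s) := by gcongr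
      _ ≤ _ := by linarith
  · refine ((setLIntegral_le_lintegral _ _).trans
      (lintegral_density_kernelFunction_le hp hγ hN ha)).trans (ENNReal.ofReal_le_ofReal ?_)
    calc _ ≤ V * 4 ^ (γ + 2) * 2 * s := by gcongr
      _ ≤ _ := by
        have : 0 ≤ V * s := by positivity
        linarith

/-- A single kernel is bounded on the disk, so its mass in a ball of radius `s` is `O(s ^ (α + 3))`;
here the constant may depend on `a`. -/
theorem kernelFunction_mem_littleAnalyticTent {ζ p α : ℝ} (hp : 0 < p) (hα : -2 < α) {N : ℕ}
    (hN : α + 4 ≤ N * p) {a : ℂ} (ha : a ∈ disk) :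
    kernelFunction ((α + 1 + 1) / p) N a ∈ littleAnalyticTent ζ p α := by
  have hpi := Real.pi_pos
  have hd : 0 < 1 - ‖a‖ := by have := mem_disk.1 ha; linarith
  have hα1 : 0 < α + 1 + 1 := by linarith
  obtain ⟨M, hM, hcb⟩ := exists_carlesonBound_kernelFunction (γ := α + 1) hp (by linarith)
    (N := N) (by linarith)
  refine mem_littleAnalyticTent_of_carlesonBound hp hα1 hM.le (kernelFunction_mem _ N ha)
    (hcb a ha) fun ε hε => ?_
  refine ⟨(1 - ‖a‖) ^ (-(α + 1 + 1)) * (2 * Real.pi / (α + 1 + 1)), by positivity,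
    fun η hη s hs => ?_⟩
  refine (lintegral_density_kernelFunction_ball_le hp (by linarith) N ha hη hs).trans
    (ENNReal.ofReal_le_ofReal ?_)
  have h2 : s ^ (α + 1 + 2) = s ^ (α + 1 + 1) * s := by
    rw [← Real.rpow_add_one hs.ne']; congr 1; ring
  rw [h2]
  have : 0 ≤ ε * s := by positivity
  linarith

theorem norm_iteratedDeriv_kernelFunction_ge (κ : ℝ) {N : ℕ} (hN : 0 < N) (k : ℕ) {a : ℂ}
    (ha : a ∈ disk) :
    2⁻¹ ^ (N + k) * ‖a‖ ^ k * (1 - ‖a‖) ^ (-κ - k) ≤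
      ‖iteratedDeriv k (kernelFunction κ N a) a‖ := by
  have ha1 := mem_disk.1 ha
  have hn := norm_nonneg a
  have hd : 0 < 1 - ‖a‖ := by linarith
  have hself : ‖1 - conj a * a‖ ≤ 2 * (1 - ‖a‖) := by
    have : 1 - conj a * a = ((1 - ‖a‖ ^ 2 : ℝ) : ℂ) := by
      rw [mul_comm, Complex.mul_conj, Complex.normSq_eq_norm_sq]; push_cast; ring
    rw [this, Complex.norm_real, Real.norm_of_nonneg (by nlinarith)]
    nlinarith
  have hpos : 0 < ‖1 - conj a * a‖ := norm_pos_iff.2 (one_sub_conj_mul_ne_zero ha ha)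
  rw [iteratedDeriv_kernelFunction κ N ha k ha]
  simp only [norm_mul, norm_inv, norm_pow, Complex.norm_real, Complex.norm_natCast,
    RCLike.norm_conj]
  rw [Real.norm_of_nonneg (by positivity)]
  have hasc : (1 : ℝ) ≤ N.ascFactorial k := by
    exact_mod_cast (Nat.one_le_pow k N hN).trans (Nat.pow_succ_le_ascFactorial N k)
  calc 2⁻¹ ^ (N + k) * ‖a‖ ^ k * (1 - ‖a‖) ^ (-κ - k)
      = (1 - ‖a‖) ^ ((N : ℝ) - κ) * (1 * ‖a‖ ^ k * ((2 * (1 - ‖a‖)) ^ (N + k))⁻¹) := by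
        have h1 : (1 - ‖a‖) ^ (-κ - k) =
            (1 - ‖a‖) ^ ((N : ℝ) - κ) * ((1 - ‖a‖) ^ (N + k))⁻¹ := by
          rw [← Real.rpow_natCast, ← Real.rpow_neg hd.le, ← Real.rpow_add hd]
          congr 1; push_cast; ring
        rw [h1, mul_pow, mul_inv, inv_pow]; ring
    _ ≤ _ := by gcongr

/-! ### Necessity -/

theorem weightedSup_lt_top_of_boundedLittleTent {ζ p q α β : ℝ} (hζ : 1 / 2 < ζ) (hp : 0 < p)
    (hpq : p ≤ q) (hα : -2 < α) (hβ : -2 < β) {g : ℂ → ℂ} (hg : g ∈ analyticOnDisk) {n k : ℕ}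
    (hT : BoundedLittleTent ζ p α q β (genIntegrationOp g n k)) :
    weightedSup p q α β n k g < ⊤ := by
  have hq : 0 < q := hp.trans_le hpq
  obtain ⟨C, hC⟩ := hT
  obtain ⟨N, hNlt⟩ := exists_nat_gt (max ((α + 4) / p) 0)
  have hN0 : 0 < N := by exact_mod_cast (le_max_right _ _).trans_lt hNlt
  have hN : α + 4 ≤ N * p := by
    rw [← div_le_iff₀ hp]; exact (le_max_left _ _).trans hNlt.le
  set κ : ℝ := (α + 1 + 1) / p with hκ
  obtain ⟨M₁, hM₁, hker⟩ := exists_carlesonBound_kernelFunction (γ := α + 1) hp (by linarith)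
    (N := N) (by linarith)
  obtain ⟨C₁, hC₁, hcar⟩ := exists_carlesonBound_of_analyticTent hζ hq hβ
  obtain ⟨C₂, hC₂, hder⟩ := exists_carlesonBound_iteratedDeriv hq (β + 1) 0 n
  obtain ⟨C₃, hC₃, hgrow⟩ := exists_growth_of_carlesonBound hq (β + 1 + n * q) 0
  set Y : ℝ := C * (2 ^ (|α + 1| + 1) * M₁) ^ (1 / p) with hY
  have hY0 : 0 ≤ Y := by positivity
  set X : ℝ := C₃ * (C₂ * (C₁ * Y ^ q)) with hX
  have hX0 : 0 ≤ X := by positivity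
  set e : ℝ := (n : ℝ) - k + (β + 2) / q - (α + 2) / p with he
  -- The factor `‖a‖ ^ k` is unavoidable here: the `k`-th derivative of the kernel carries `conj a ^
  -- k`. It is removed below, by continuity on `‖a‖ ≤ 1 / 2` and by `2 * ‖a‖ ≥ 1` elsewhere.
  have hkey : ∀ a ∈ disk, ‖a‖ ^ k * (‖iteratedDeriv (n - k) g a‖ * (1 - ‖a‖) ^ e) ≤
      2 ^ (N + k) * X ^ (1 / q) := by
    intro a ha
    have ha1 := mem_disk.1 ha
    have hd : 0 < 1 - ‖a‖ := by linarith
    set f := kernelFunction κ N a with hf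
    have hfmem : f ∈ littleAnalyticTent ζ p α := kernelFunction_mem_littleAnalyticTent hp hα hN ha
    obtain ⟨hTf, hTn⟩ := hC f hfmem
    have hnorm : (tentNorm ζ q β (genIntegrationOp g n k f)).toReal ≤ Y := by
      refine ENNReal.toReal_le_of_le_ofReal hY0 (hTn.trans ?_)
      rw [hY, ENNReal.ofReal_mul (NNReal.coe_nonneg C), ENNReal.ofReal_coe_nnreal]
      exact mul_le_mul' le_rfl (tentNorm_le_of_carlesonBound hp hM₁.le (hker a ha))
    have h1 : CarlesonBound q (β + 1) (genIntegrationOp g n k f) fun _ => C₁ * Y ^ q :=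
      (hcar _ hTf.1).mono fun s _ => by gcongr
    have hgauge : IsGauge 0 fun _ => C₁ * Y ^ q := isGauge_const le_rfl (by positivity)
    have h2 := hder _ hTf.1.1 _ hgauge h1
    have h3 := hgrow _ (iteratedDeriv_mem hTf.1.1 n) _ (hgauge.const_mul hC₂.le) h2 a ha
    have h4 : iteratedDeriv n (genIntegrationOp g n k f) a =
        iteratedDeriv k f a * iteratedDeriv (n - k) g a :=
      iteratedDeriv_iterate_integrationOp (genIntegrand_mem hfmem.1.1 hg k (n - k)) n ha
    rw [h4, norm_mul] at h3
    have h5 : ‖iteratedDeriv k f a‖ * ‖iteratedDeriv (n - k) g a‖ *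
        (1 - ‖a‖) ^ ((β + 2) / q + n) ≤ X ^ (1 / q) := by
      rw [one_div, Real.le_rpow_inv_iff_of_pos (by positivity) hX0 hq,
        Real.mul_rpow (by positivity) (by positivity), ← Real.rpow_mul hd.le]
      convert h3 using 3
      field_simp; ring
    have h6 := norm_iteratedDeriv_kernelFunction_ge κ hN0 k ha
    have h7 : (1 - ‖a‖) ^ e = (1 - ‖a‖) ^ (-κ - k) * (1 - ‖a‖) ^ ((β + 2) / q + n) := by
      rw [← Real.rpow_add hd, he, hκ]; congr 1; ring
    calc ‖a‖ ^ k * (‖iteratedDeriv (n - k) g a‖ * (1 - ‖a‖) ^ e)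
        = 2 ^ (N + k) * (2⁻¹ ^ (N + k) * ‖a‖ ^ k * (1 - ‖a‖) ^ (-κ - k) *
          ‖iteratedDeriv (n - k) g a‖ * (1 - ‖a‖) ^ ((β + 2) / q + n)) := by
          rw [h7, inv_pow]; field_simp
      _ ≤ 2 ^ (N + k) * (‖iteratedDeriv k f a‖ * ‖iteratedDeriv (n - k) g a‖ *
          (1 - ‖a‖) ^ ((β + 2) / q + n)) := by gcongr
      _ ≤ _ := by gcongr
  have hcont : ContinuousOn (fun z => ‖iteratedDeriv (n - k) g z‖ * (1 - ‖z‖) ^ e)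
      (closedBall 0 (1 / 2)) := by
    have hsub : closedBall (0 : ℂ) (1 / 2) ⊆ disk := closedBall_subset_ball (by norm_num)
    refine ((DifferentiableOn.continuousOn (iteratedDeriv_mem hg (n - k))).mono hsub).norm.mul
      (ContinuousOn.rpow_const (by fun_prop) fun z hz => Or.inl ?_)
    have := mem_disk.1 (hsub hz)
    linarith
  obtain ⟨B, hB⟩ := (isCompact_closedBall (0 : ℂ) (1 / 2)).bddAbove_image hcont
  set Z : ℝ := max B (2 ^ k * (2 ^ (N + k) * X ^ (1 / q))) with hZ
  have hall : ∀ a ∈ disk, ‖iteratedDeriv (n - k) g a‖ * (1 - ‖a‖) ^ e ≤ Z := by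
    intro a ha
    have ha1 := mem_disk.1 ha
    have hd : 0 < 1 - ‖a‖ := by linarith
    rcases le_or_gt ‖a‖ (1 / 2) with h | h
    · exact (hB ⟨a, mem_closedBall_zero_iff.2 h, rfl⟩).trans (le_max_left _ _)
    · refine le_trans ?_ (le_max_right _ _)
      have h2 : (1 : ℝ) ≤ 2 ^ k * ‖a‖ ^ k := by
        rw [← mul_pow]; exact one_le_pow₀ (by linarith)
      calc _ ≤ 2 ^ k * ‖a‖ ^ k * (‖iteratedDeriv (n - k) g a‖ * (1 - ‖a‖) ^ e) :=
            le_mul_of_one_le_left (by positivity) h2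
        _ = 2 ^ k * (‖a‖ ^ k * (‖iteratedDeriv (n - k) g a‖ * (1 - ‖a‖) ^ e)) := mul_assoc _ _ _
        _ ≤ _ := mul_le_mul_of_nonneg_left (hkey a ha) (by positivity)
  refine lt_of_le_of_lt (iSup₂_le fun a ha => ENNReal.ofReal_le_ofReal ?_)
    (ENNReal.ofReal_lt_top (r := 2 ^ |e| * Z))
  calc _ ≤ ‖iteratedDeriv (n - k) g a‖ * (2 ^ |e| * (1 - ‖a‖) ^ e) := by
        gcongr
        exact (one_sub_sq_rpow_le ha e).1
    _ = 2 ^ |e| * (‖iteratedDeriv (n - k) g a‖ * (1 - ‖a‖) ^ e) := by ring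
    _ ≤ _ := by gcongr; exact hall a ha

end TentSpace

theorem theorem3p2 (ζ : ℝ) (hζ : 1 / 2 < ζ) (p q α β : ℝ) (hp : 0 < p) (hpq : p ≤ q)
    (hα : -2 < α) (hβ : -2 < β) (g : ℂ → ℂ) (hg : g ∈ TentSpace.analyticOnDisk)
    (n k : ℕ) (hn : 0 < n) (hk : k < n) :
    TentSpace.BoundedLittleTent ζ p α q β (TentSpace.genIntegrationOp g n k) ↔
      TentSpace.weightedSup p q α β n k g < (⊤ : ENNReal) :=
  ⟨TentSpace.weightedSup_lt_top_of_boundedLittleTent hζ hp hpq hα hβ hg,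
    TentSpace.boundedLittleTent_of_weightedSup_lt_top hζ hp hpq hα hβ hg⟩
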